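/- Let $m=m_n$ be positive integers (from some $n$ on) with $m_n\to\infty$ as $n\to\infty$, put $\beta_n=m_n/n$, and let $P=P_n$ be a probability distribution on $\{0,1,\dots,m_n\}$. Let $D_1,\dots,D_n$ be independent random subsets of $W=\{w_1,\dots,w_m\}$ with $\mathbf P(D_i=A)=\binom{m}{|A|}^{-1}P(|A|)$ for every $A\subseteq W$, and $X_i=|D_i|$. The passive random intersection graph $G_1^*(n,m,P)$ has the vertex set $W$; two distinct vertices are adjacent if some $D_k$ contains both. Let $(v_1^*,v_2^*)$ be a uniformly random ordered pair of distinct vertices, independent of the graph, let $d(v)$ denote the degree of $v$, and put $\mathbf E^*f=\mathbf E\big(f\,\mathbb I_{\{v_1^*\sim v_2^*\}}\big)/\mathbf P(v_1^*\sim v_2^*)$. The assortativity coefficient is $$r=\frac{g-b^2}{b'-b^2},\qquad g=\mathbf E^*d(v_1^*)d(v_2^*),\quad b=\mathbf E^*d(v_1^*),\quad b'=\mathbf E^*d^2(v_1^*).$$ Write $(x)_i=x(x-1)\cdots(x-i+1)$ and $y_i=\mathbf E(X_1)_i$ (which depends on $n$). Assume that, as $n\to\infty$, (iii) $X_1$ converges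 in distribution to a random variable $Z$ (with values in $\{0,1,2,\dots\}$), and (v) $\mathbf P(Z\ge 2)>0$, $\mathbf E Z^4<\infty$ and $\mathbf E X_1^4\to\mathbf E Z^4$. (a) If $\beta_n\to\beta\in(0,\infty)$, then $$r=\frac{y_2y_4+y_2y_3-y_3^2}{y_2y_4+y_2y_3-y_3^2+\beta_n^{-1}y_2^2(y_2+y_3)}+o(1)\qquad(1)$$ and $$r=1-\frac{\delta_{*2}\delta_{*1}^2-\delta_{*1}^4}{\delta_{*1}\delta_{*3}-\delta_{*2}^2}+o(1).$$ Here $\delta_{*i}=\mathbf E d_{**}^i$ (finite for $i\le 3$), where $d_{**}=\sum_{j=1}^{\Lambda}\tilde Z_j$, the variables $\tilde Z_1,\tilde Z_2,\dots$ are independent with $\mathbf P(\tilde Z_1=j)=(j+1)\mathbf P(Z=j+1)/\mathbf E Z$, $j=0,1,\dots$, and $\Lambda$ is independent of them and has the Poisson distribution with mean $\beta^{-1}\mathbf E Z$. (b) If $\beta_n\to\infty$, then (1) holds; and if, in addition, $\mathbf P(Z=i)>0$ for at least two integers $i\ge 2$, then $r=1-o(1)$. (c) If $\beta_n\to 0$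 and $n\beta_n^3\to\infty$, then $r=o(1)$. -/

import Mathlib

open MeasureTheory ProbabilityTheory Filter Topology

noncomputable section

namespace PassiveRIG

/-- The graph on `W = Fin m` defined by the sets `D 0, …, D (n - 1)`: two distinct
elements of `W` are adjacent if some `D k` contains both of them. -/
def passiveGraph {n m : ℕ} (D : Fin n → Finset (Fin m)) : SimpleGraph (Fin m) where
  Adj v w := v ≠ w ∧ ∃ k, v ∈ D k ∧ w ∈ D k
  symm := ⟨fun _ _ h => ⟨h.1.symm, h.2.imp fun _ hk => ⟨hk.2, hk.1⟩⟩⟩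
  loopless := ⟨fun _ h => h.1 rfl⟩

instance {n m : ℕ} (D : Fin n → Finset (Fin m)) : DecidableRel (passiveGraph D).Adj :=
  fun _ _ => inferInstanceAs (Decidable (_ ∧ _))

/-- The probability `P(|A|) / (m choose |A|)` that the random subset of `Fin m` equals `A`:
its size has distribution `P`, and all subsets of the same size are equally likely. -/
def setProb {m : ℕ} (P : PMF (Fin (m + 1))) (A : Finset (Fin m)) : ℝ :=
  (P (Fin.ofNat (m + 1) A.card)).toReal / (m.choose A.card : ℝ)

/-- The probability that `n` independent random sets with the law `setProb P` are
`D 0, …, D (n - 1)`. -/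
def familyProb {n m : ℕ} (P : PMF (Fin (m + 1))) (D : Fin n → Finset (Fin m)) : ℝ :=
  ∏ k, setProb P (D k)

/-- The expectation `E f(G, v₁*, v₂*)`, where `G` is the passive random intersection graph
defined by `n` random subsets of `Fin m`, and `(v₁*, v₂*)` is an ordered pair of distinct
vertices, uniformly distributed and independent of `G`. -/
def pairMean (n : ℕ) {m : ℕ} (P : PMF (Fin (m + 1)))
    (f : SimpleGraph (Fin m) → Fin m → Fin m → ℝ) : ℝ :=
  ∑ D : Fin n → Finset (Fin m), familyProb P D *
    ((∑ p ∈ (Finset.univ : Finset (Fin m)).offDiag, f (passiveGraph D) p.1 p.2) /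
      ((m : ℝ) * ((m : ℝ) - 1)))

open Classical in
/-- The indicator of adjacency. -/
def adjInd {m : ℕ} (G : SimpleGraph (Fin m)) (v w : Fin m) : ℝ := if G.Adj v w then 1 else 0

open Classical in
/-- The degree of a vertex, as a real number. -/
def deg {m : ℕ} (G : SimpleGraph (Fin m)) (v : Fin m) : ℝ := (G.degree v : ℝ)

/-- The edge probability `P(v₁* ∼ v₂*)`. -/
def edgeProb (n : ℕ) {m : ℕ} (P : PMF (Fin (m + 1))) : ℝ := pairMean n P adjInd

/-- The conditional expectation `E* f = E (f 1{v₁* ∼ v₂*}) / P(v₁* ∼ v₂*)`. -/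
def edgeMean (n : ℕ) {m : ℕ} (P : PMF (Fin (m + 1)))
    (f : SimpleGraph (Fin m) → Fin m → Fin m → ℝ) : ℝ :=
  pairMean n P (fun G v w => f G v w * adjInd G v w) / edgeProb n P

/-- `b = E* d(v₁*)`. -/
def bMean (n : ℕ) {m : ℕ} (P : PMF (Fin (m + 1))) : ℝ := edgeMean n P fun G v _ => deg G v

/-- `b' = E* d(v₁*)²`. -/
def bSqMean (n : ℕ) {m : ℕ} (P : PMF (Fin (m + 1))) : ℝ :=
  edgeMean n P fun G v _ => deg G v ^ 2

/-- `g = E* d(v₁*) d(v₂*)`. -/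
def gMean (n : ℕ) {m : ℕ} (P : PMF (Fin (m + 1))) : ℝ :=
  edgeMean n P fun G v w => deg G v * deg G w

/-- The assortativity coefficient `r = (g - b²) / (b' - b²)`. -/
def assortativity (n : ℕ) {m : ℕ} (P : PMF (Fin (m + 1))) : ℝ :=
  (gMean n P - bMean n P ^ 2) / (bSqMean n P - bMean n P ^ 2)

/-- The moment `E X^i` of the set size `X ∼ P`. -/
def sizeMoment {m : ℕ} (P : PMF (Fin (m + 1))) (i : ℕ) : ℝ :=
  ∑ k : Fin (m + 1), (P k).toReal * ((k : ℕ) : ℝ) ^ i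

/-- The factorial moment `y_i = E X (X - 1) ⋯ (X - i + 1)` of the set size `X ∼ P`. -/
def sizeFactMoment {m : ℕ} (P : PMF (Fin (m + 1))) (i : ℕ) : ℝ :=
  ∑ k : Fin (m + 1), (P k).toReal * ((k : ℕ).descFactorial i : ℝ)

/-- The right-hand side
`(y₂ y₄ + y₂ y₃ - y₃²) / (y₂ y₄ + y₂ y₃ - y₃² + β⁻¹ y₂² (y₂ + y₃))`. -/
def assortFormula {m : ℕ} (P : PMF (Fin (m + 1))) (β : ℝ) : ℝ :=
  let y := sizeFactMoment P
  (y 2 * y 4 + y 2 * y 3 - y 3 ^ 2) /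
    (y 2 * y 4 + y 2 * y 3 - y 3 ^ 2 + β⁻¹ * y 2 ^ 2 * (y 2 + y 3))

/-- The moment `E Y^i` of a random variable `Y` with law `Q` on the natural numbers. -/
def moment (Q : PMF ℕ) (i : ℕ) : ℝ := ∫ k : ℕ, (k : ℝ) ^ i ∂Q.toMeasure

open Classical in
/-- The law `P(Z̃ = j) = (j + 1) P(Z = j + 1) / E Z` on `0, 1, 2, …`, where `Z` has the law `Q`;
the point mass at `0` if `E Z = 0`. (The weights `(j + 1) P(Z = j + 1)` have the sum `E Z`.
The case `E Z = ∞` plays no role.) -/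
def tildeLaw (Q : PMF ℕ) : PMF ℕ :=
  if h : (∑' j : ℕ, ((j + 1 : ℕ) : ENNReal) * Q (j + 1)) ≠ 0 ∧
      (∑' j : ℕ, ((j + 1 : ℕ) : ENNReal) * Q (j + 1)) ≠ ⊤ then
    PMF.normalize (fun j : ℕ => ((j + 1 : ℕ) : ENNReal) * Q (j + 1)) h.1 h.2
  else PMF.pure 0

/-- The law of the sum of `k` independent random variables with the law `R`. -/
def iidSumLaw (R : PMF ℕ) : ℕ → PMF ℕ
  | 0 => PMF.pure 0
  | k + 1 => (iidSumLaw R k).bind fun s => R.map fun z => s + z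

/-- The compound Poisson law of `d_** = Z̃₁ + ⋯ + Z̃_Λ`, where `Λ` is Poisson with mean
`β⁻¹ E Z` and independent of the independent variables `Z̃₁, Z̃₂, …`, whose law is
`tildeLaw Q`; here `Z` has the law `Q`. -/
def degreeLaw (Q : PMF ℕ) (β : ℝ) : PMF ℕ :=
  (poissonMeasure (Real.toNNReal (β⁻¹ * moment Q 1))).toPMF.bind
    fun k => iidSumLaw (tildeLaw Q) k

end PassiveRIG

end

noncomputable section

namespace PassiveRIG

open Asymptotics

/-! Non-adjacency is the event `miss` that no set contains both points, and the mean of a product of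
`miss` factors splits over the independent sets. Inclusion–exclusion thus yields exact values of
`edgeP`, `cherryP`, `triP`, `pathP` and `starP`, and expanding degrees into adjacency indicators
makes r an exact quotient of polynomials in them (`assortativity_eq`).

Put μ = 1/m, u = n/m² and κ = u/μ = 1/β_n. An edge has probability about u y₂; one set covering
three or four given points contributes about u μ y₃ or u μ² y₄. Numerator and denominator of r are
covariance-like differences whose leading terms cancel before being multiplied by m², so crude
expansions are too weak. Instead each power is written exactly as a power of A = (1 - q₂)^n times 1
+ O(uμ) (`exists_expansions`), and the contributions of independent edges cancel identically
(`numerator_identity`, `denominator_identity`). Once u → 0, division by u² leaves V in the numerator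
and V + κU in the denominator, with V = y₂y₄ + y₂y₃ - y₃² and U = y₂²(y₂ + y₃). This is (1).

The errors in V are O(μ + u), and they must be small relative to κ because V and κ may both tend to
0. They are: (μ + u)/κ = 1/n + 1/m. After division by κ the denominator is U + V/κ ≥ U, since V is
y₂ times a weighted sum of squares (`hasSum_sizeBiased_variance`).

It remains to see that u → 0 in all three regimes, to pass to the limit in the factorial moments by
a Scheffé argument (`tendsto_sizeFactMoment`), and to let κ tend to 1/β, 0 or ∞. The formula in the
δ's follows by algebra from the compound Poisson moments (`degreeLaw_moments`). -/

/-! ### Covering probabilities -/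

/-- The indicator of `J ⊆ A`. -/
def cov {m : ℕ} (J A : Finset (Fin m)) : ℝ := if J ⊆ A then 1 else 0

lemma cov_mul_cov {m : ℕ} (J K A : Finset (Fin m)) : cov J A * cov K A = cov (J ∪ K) A := by
  simp only [cov, Finset.union_subset_iff]
  split_ifs <;> simp_all

/-- The probability that a random set with size law `P` contains `j` given points. -/
def covProb {m : ℕ} (P : PMF (Fin (m + 1))) (j : ℕ) : ℝ :=
  sizeFactMoment P j / (m.descFactorial j : ℝ)

lemma card_filter_superset {m : ℕ} (J : Finset (Fin m)) {k : ℕ} (hk : J.card ≤ k) :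
    (Finset.univ.filter fun A : Finset (Fin m) => A.card = k ∧ J ⊆ A).card
      = (m - J.card).choose (k - J.card) := by
  have h1 : (Finset.univ.filter fun A : Finset (Fin m) => A.card = k ∧ J ⊆ A)
      = (Jᶜ.powersetCard (k - J.card)).image (J ∪ ·) := by
    ext A
    simp only [Finset.mem_filter, Finset.mem_univ, true_and, Finset.mem_image,
      Finset.mem_powersetCard]
    constructor
    · rintro ⟨hc, hJ⟩
      refine ⟨A \ J, ⟨?_, ?_⟩, Finset.union_sdiff_of_subset hJ⟩
      · intro x hx
        simp only [Finset.mem_sdiff] at hx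
        simpa using hx.2
      · rw [Finset.card_sdiff_of_subset hJ, hc]
    · rintro ⟨B, ⟨hB, hc⟩, rfl⟩
      have hd : Disjoint J B := by
        rw [Finset.disjoint_left]
        intro x hx hx'
        simpa [hx] using hB hx'
      refine ⟨?_, Finset.subset_union_left⟩
      rw [Finset.card_union_of_disjoint hd, hc]
      omega
  rw [h1, Finset.card_image_of_injOn, Finset.card_powersetCard, Finset.card_compl, Fintype.card_fin]
  intro B hB C hC h
  rw [Finset.mem_coe, Finset.mem_powersetCard] at hB hC
  have key : ∀ B : Finset (Fin m), B ⊆ Jᶜ → (J ∪ B) \ J = B := by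
    intro B hB
    ext x
    have := @hB x
    simp only [Finset.mem_compl] at this
    simp only [Finset.mem_sdiff, Finset.mem_union]
    tauto
  have h' : J ∪ B = J ∪ C := h
  rw [← key B hB.1, ← key C hC.1, h']

lemma choose_sub_mul_descFactorial {m k j : ℕ} (hj : j ≤ k) :
    (m - j).choose (k - j) * m.descFactorial j = k.descFactorial j * m.choose k := by
  rw [Nat.descFactorial_eq_factorial_mul_choose, Nat.descFactorial_eq_factorial_mul_choose]
  have := Nat.choose_mul (n := m) hj
  calc _ = j.factorial * (m.choose j * (m - j).choose (k - j)) := by ring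
    _ = _ := by rw [← this]; ring

/-- Given its size k, the set contains j given points with probability (k)_j/(m)_j; averaging over k
leaves E(X)_j/(m)_j. Sizes k < j need no exception since (k)_j = 0. -/
lemma sum_setProb_mul_cov {m : ℕ} (P : PMF (Fin (m + 1))) (J : Finset (Fin m)) :
    ∑ A, setProb P A * cov J A = covProb P J.card := by
  have hJm : J.card ≤ m := by simpa using J.card_le_univ
  have hval : ∀ A : Finset (Fin m), ((Fin.ofNat (m + 1) A.card : Fin (m + 1)) : ℕ) = A.card := by
    intro A
    have : A.card ≤ m := by simpa using A.card_le_univ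
    simp only [Fin.ofNat]
    exact Nat.mod_eq_of_lt (by omega)
  rw [← Finset.sum_fiberwise (s := Finset.univ)
    (g := fun A : Finset (Fin m) => (Fin.ofNat (m + 1) A.card : Fin (m + 1)))]
  rw [covProb, sizeFactMoment, Finset.sum_div]
  refine Finset.sum_congr rfl fun k _ => ?_
  have hset : (Finset.univ.filter fun A : Finset (Fin m) =>
      (Fin.ofNat (m + 1) A.card : Fin (m + 1)) = k)
      = Finset.univ.filter fun A : Finset (Fin m) => A.card = (k : ℕ) := by
    ext A
    simp only [Finset.mem_filter, Finset.mem_univ, true_and, Fin.ext_iff, hval]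
  have hterm : ∀ A ∈ Finset.univ.filter (fun A : Finset (Fin m) => A.card = (k : ℕ)),
      setProb P A * cov J A
        = if J ⊆ A then (P k).toReal / (m.choose (k : ℕ) : ℝ) else 0 := by
    intro A hA
    simp only [Finset.mem_filter, Finset.mem_univ, true_and] at hA
    have hk : (Fin.ofNat (m + 1) A.card : Fin (m + 1)) = k := Fin.ext (by rw [hval, hA])
    rw [setProb, cov, hk, hA]
    split_ifs <;> simp
  rw [hset, Finset.sum_congr rfl hterm, ← Finset.sum_filter, Finset.filter_filter,
    Finset.sum_const, nsmul_eq_mul]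
  have hkm : (k : ℕ) ≤ m := Nat.lt_succ_iff.mp k.2
  have h1 : (0 : ℝ) < m.choose (k : ℕ) := by exact_mod_cast Nat.choose_pos hkm
  have h2 : (0 : ℝ) < m.descFactorial J.card := by
    exact_mod_cast Nat.descFactorial_pos.2 hJm
  rcases le_or_gt J.card (k : ℕ) with hjk | hjk
  · rw [card_filter_superset J hjk]
    have h3 : (((m - J.card).choose ((k : ℕ) - J.card) : ℕ) : ℝ) * m.descFactorial J.card
        = ((k : ℕ).descFactorial J.card : ℝ) * m.choose (k : ℕ) := by
      exact_mod_cast choose_sub_mul_descFactorial (m := m) hjk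
    field_simp
    linear_combination (P k).toReal * h3
  · have : (Finset.univ.filter fun A : Finset (Fin m) => A.card = (k : ℕ) ∧ J ⊆ A) = ∅ := by
      rw [Finset.filter_eq_empty_iff]
      rintro A - ⟨h, h'⟩
      have := Finset.card_le_card h'
      omega
    rw [this, Nat.descFactorial_eq_zero_iff_lt.2 hjk]
    simp

lemma sizeFactMoment_zero {m : ℕ} (P : PMF (Fin (m + 1))) : sizeFactMoment P 0 = 1 := by
  have h := P.tsum_coe
  rw [tsum_fintype] at h
  simp only [sizeFactMoment, Nat.descFactorial_zero, Nat.cast_one, mul_one]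
  rw [← ENNReal.toReal_sum fun k _ => P.apply_ne_top k, h, ENNReal.toReal_one]

lemma sum_setProb {m : ℕ} (P : PMF (Fin (m + 1))) : ∑ A, setProb P A = 1 := by
  have h := sum_setProb_mul_cov P ∅
  simpa [cov, covProb, sizeFactMoment_zero] using h

/-! ### Expectations over families of sets -/

/-- The expectation over `n` independent random sets. -/
def familyMean {n m : ℕ} (P : PMF (Fin (m + 1))) (f : (Fin n → Finset (Fin m)) → ℝ) : ℝ :=
  ∑ D, familyProb P D * f D

section
variable {n m : ℕ} (P : PMF (Fin (m + 1)))

lemma familyMean_add (f g : (Fin n → Finset (Fin m)) → ℝ) :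
    familyMean P (fun D => f D + g D) = familyMean P f + familyMean P g := by
  simp only [familyMean, mul_add, Finset.sum_add_distrib]

lemma familyMean_sub (f g : (Fin n → Finset (Fin m)) → ℝ) :
    familyMean P (fun D => f D - g D) = familyMean P f - familyMean P g := by
  simp only [familyMean, mul_sub, Finset.sum_sub_distrib]

lemma familyMean_sum {ι : Type*} (s : Finset ι) (f : ι → (Fin n → Finset (Fin m)) → ℝ) :
    familyMean P (fun D => ∑ i ∈ s, f i D) = ∑ i ∈ s, familyMean P (f i) := by
  simp only [familyMean, Finset.mul_sum]
  exact Finset.sum_comm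

/-- Independence of the sets: expanding the n-th power of a sum over sets gives a sum over families.
-/
lemma familyMean_prod (φ : Finset (Fin m) → ℝ) :
    familyMean P (fun D : Fin n → Finset (Fin m) => ∏ k, φ (D k))
      = (∑ A, setProb P A * φ A) ^ n := by
  rw [Fintype.sum_pow]
  simp only [familyMean, familyProb, Finset.prod_mul_distrib]

lemma familyMean_one : familyMean P (fun _ : Fin n → Finset (Fin m) => (1 : ℝ)) = 1 := by
  have := familyMean_prod (n := n) P (fun _ => 1)
  simpa [sum_setProb] using this

end

/-- The indicator that no set of the family contains `J`. -/
def miss {n m : ℕ} (J : Finset (Fin m)) (D : Fin n → Finset (Fin m)) : ℝ := ∏ k, (1 - cov J (D k))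

section
variable {n m : ℕ} (P : PMF (Fin (m + 1)))

lemma familyMean_miss (J : Finset (Fin m)) :
    familyMean P (fun D : Fin n → Finset (Fin m) => miss J D) = (1 - covProb P J.card) ^ n := by
  simp only [miss]
  rw [familyMean_prod P fun A => 1 - cov J A]
  congr 1
  simp only [mul_sub, mul_one, Finset.sum_sub_distrib, sum_setProb, sum_setProb_mul_cov]

lemma familyMean_miss_mul (J K : Finset (Fin m)) :
    familyMean P (fun D : Fin n → Finset (Fin m) => miss J D * miss K D)
      = (1 - covProb P J.card - covProb P K.card + covProb P (J ∪ K).card) ^ n := by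
  simp only [miss, ← Finset.prod_mul_distrib]
  rw [familyMean_prod P fun A => (1 - cov J A) * (1 - cov K A)]
  congr 1
  have h : ∀ A, setProb P A * ((1 - cov J A) * (1 - cov K A))
      = setProb P A - setProb P A * cov J A - setProb P A * cov K A
        + setProb P A * cov (J ∪ K) A := by
    intro A
    rw [← cov_mul_cov]
    ring
  simp only [h, Finset.sum_add_distrib, Finset.sum_sub_distrib, sum_setProb, sum_setProb_mul_cov]

lemma familyMean_miss_mul_mul (J K L : Finset (Fin m)) :
    familyMean P (fun D : Fin n → Finset (Fin m) => miss J D * miss K D * miss L D)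
      = (1 - covProb P J.card - covProb P K.card - covProb P L.card + covProb P (J ∪ K).card
        + covProb P (J ∪ L).card + covProb P (K ∪ L).card - covProb P (J ∪ K ∪ L).card) ^ n := by
  simp only [miss, ← Finset.prod_mul_distrib]
  rw [familyMean_prod P fun A => (1 - cov J A) * (1 - cov K A) * (1 - cov L A)]
  congr 1
  have h : ∀ A, setProb P A * ((1 - cov J A) * (1 - cov K A) * (1 - cov L A))
      = setProb P A - setProb P A * cov J A - setProb P A * cov K A - setProb P A * cov L A
        + setProb P A * cov (J ∪ K) A + setProb P A * cov (J ∪ L) A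
        + setProb P A * cov (K ∪ L) A - setProb P A * cov (J ∪ K ∪ L) A := by
    intro A
    simp only [← cov_mul_cov]
    ring
  simp only [h, Finset.sum_add_distrib, Finset.sum_sub_distrib, sum_setProb, sum_setProb_mul_cov]

end

/-! ### Probabilities of small subgraphs -/

lemma adjInd_self {m : ℕ} (G : SimpleGraph (Fin m)) (v : Fin m) : adjInd G v v = 0 := by
  simp [adjInd]

lemma adjInd_comm {m : ℕ} (G : SimpleGraph (Fin m)) (v w : Fin m) :
    adjInd G v w = adjInd G w v := by
  by_cases h : G.Adj v w
  · simp [adjInd, h, h.symm]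
  · have h1 : ¬ G.Adj w v := fun h1 => h h1.symm
    simp [adjInd, h, h1]

lemma adjInd_mul_self {m : ℕ} (G : SimpleGraph (Fin m)) (v w : Fin m) :
    adjInd G v w * adjInd G v w = adjInd G v w := by
  simp only [adjInd]
  split_ifs <;> simp

lemma deg_eq_sum {m : ℕ} (G : SimpleGraph (Fin m)) (v : Fin m) :
    deg G v = ∑ u, adjInd G v u := by
  classical
  simp only [deg, adjInd, Finset.sum_boole]
  rw [← SimpleGraph.card_neighborFinset_eq_degree, SimpleGraph.neighborFinset_eq_filter]

lemma adjInd_passiveGraph {n m : ℕ} (D : Fin n → Finset (Fin m)) {v w : Fin m} (h : v ≠ w) :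
    adjInd (passiveGraph D) v w = 1 - miss {v, w} D := by
  have hsub : ∀ A : Finset (Fin m), {v, w} ⊆ A ↔ v ∈ A ∧ w ∈ A := by
    intro A
    simp [Finset.insert_subset_iff]
  have hadj : (passiveGraph D).Adj v w ↔ ∃ k, v ∈ D k ∧ w ∈ D k := by
    simp [passiveGraph, h]
  simp only [adjInd, hadj, miss, cov, hsub]
  split_ifs with hk
  · obtain ⟨k, hk⟩ := hk
    rw [Finset.prod_eq_zero (Finset.mem_univ k) (by simp [hk])]
    simp
  · push Not at hk
    rw [Finset.prod_eq_one]
    · simp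
    · intro k _
      have := hk k
      rw [if_neg (by tauto)]
      simp

section
variable (n : ℕ) {m : ℕ} (P : PMF (Fin (m + 1)))

/-- The probability of an edge. -/
def edgeP : ℝ := 1 - (1 - covProb P 2) ^ n

/-- The probability of a path with two edges. -/
def cherryP : ℝ := 1 - 2 * (1 - covProb P 2) ^ n + (1 - 2 * covProb P 2 + covProb P 3) ^ n

/-- The probability of a triangle. -/
def triP : ℝ := 1 - 3 * (1 - covProb P 2) ^ n + 3 * (1 - 2 * covProb P 2 + covProb P 3) ^ n
  - (1 - 3 * covProb P 2 + 2 * covProb P 3) ^ n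

/-- The probability of a path with three edges. -/
def pathP : ℝ := 1 - 3 * (1 - covProb P 2) ^ n + 2 * (1 - 2 * covProb P 2 + covProb P 3) ^ n
  + (1 - 2 * covProb P 2 + covProb P 4) ^ n - (1 - 3 * covProb P 2 + 2 * covProb P 3) ^ n

/-- The probability of a star with three edges. -/
def starP : ℝ := 1 - 3 * (1 - covProb P 2) ^ n + 3 * (1 - 2 * covProb P 2 + covProb P 3) ^ n
  - (1 - 3 * covProb P 2 + 3 * covProb P 3 - covProb P 4) ^ n

variable {n}

lemma familyMean_edge {a b : Fin m} (h : a ≠ b) :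
    familyMean P (fun D : Fin n → Finset (Fin m) => adjInd (passiveGraph D) a b) = edgeP n P := by
  simp only [adjInd_passiveGraph _ h]
  rw [familyMean_sub, familyMean_one, familyMean_miss, Finset.card_pair h, edgeP]

lemma familyMean_adj_mul {a b c d : Fin m} (h : a ≠ b) (h' : c ≠ d) :
    familyMean P (fun D : Fin n → Finset (Fin m) =>
        adjInd (passiveGraph D) a b * adjInd (passiveGraph D) c d)
      = 1 - 2 * (1 - covProb P 2) ^ n
        + (1 - 2 * covProb P 2 + covProb P ({a, b} ∪ {c, d} : Finset (Fin m)).card) ^ n := by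
  simp only [adjInd_passiveGraph _ h, adjInd_passiveGraph _ h']
  have : ∀ D : Fin n → Finset (Fin m), (1 - miss {a, b} D) * (1 - miss {c, d} D)
      = 1 - miss {a, b} D - miss {c, d} D + miss {a, b} D * miss {c, d} D := fun D => by ring
  simp only [this]
  rw [familyMean_add, familyMean_sub, familyMean_sub, familyMean_one, familyMean_miss,
    familyMean_miss, familyMean_miss_mul, Finset.card_pair h, Finset.card_pair h']
  ring

lemma familyMean_adj_mul_mul {a b c d e f : Fin m} (h : a ≠ b) (h' : c ≠ d) (h'' : e ≠ f) :
    familyMean P (fun D : Fin n → Finset (Fin m) => adjInd (passiveGraph D) a b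
        * adjInd (passiveGraph D) c d * adjInd (passiveGraph D) e f)
      = 1 - 3 * (1 - covProb P 2) ^ n
        + (1 - 2 * covProb P 2 + covProb P ({a, b} ∪ {c, d} : Finset (Fin m)).card) ^ n
        + (1 - 2 * covProb P 2 + covProb P ({a, b} ∪ {e, f} : Finset (Fin m)).card) ^ n
        + (1 - 2 * covProb P 2 + covProb P ({c, d} ∪ {e, f} : Finset (Fin m)).card) ^ n
        - (1 - 3 * covProb P 2 + covProb P ({a, b} ∪ {c, d} : Finset (Fin m)).card
          + covProb P ({a, b} ∪ {e, f} : Finset (Fin m)).card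
          + covProb P ({c, d} ∪ {e, f} : Finset (Fin m)).card
          - covProb P ({a, b} ∪ {c, d} ∪ {e, f} : Finset (Fin m)).card) ^ n := by
  simp only [adjInd_passiveGraph _ h, adjInd_passiveGraph _ h', adjInd_passiveGraph _ h'']
  have : ∀ D : Fin n → Finset (Fin m),
      (1 - miss {a, b} D) * (1 - miss {c, d} D) * (1 - miss {e, f} D)
      = 1 - miss {a, b} D - miss {c, d} D - miss {e, f} D + miss {a, b} D * miss {c, d} D
        + miss {a, b} D * miss {e, f} D + miss {c, d} D * miss {e, f} D
        - miss {a, b} D * miss {c, d} D * miss {e, f} D := fun D => by ring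
  simp only [this]
  rw [familyMean_sub, familyMean_add, familyMean_add, familyMean_add, familyMean_sub,
    familyMean_sub, familyMean_sub, familyMean_one, familyMean_miss,
    familyMean_miss, familyMean_miss, familyMean_miss_mul, familyMean_miss_mul,
    familyMean_miss_mul, familyMean_miss_mul_mul, Finset.card_pair h, Finset.card_pair h',
    Finset.card_pair h'']
  ring

lemma card_three {a b c : Fin m} (hab : a ≠ b) (hac : a ≠ c) (hbc : b ≠ c) :
    ({a, b, c} : Finset (Fin m)).card = 3 := Finset.card_eq_three.2 ⟨a, b, c, hab, hac, hbc, rfl⟩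

lemma card_four {a b c d : Fin m} (hab : a ≠ b) (hac : a ≠ c) (had : a ≠ d) (hbc : b ≠ c)
    (hbd : b ≠ d) (hcd : c ≠ d) : ({a, b, c, d} : Finset (Fin m)).card = 4 := by
  rw [Finset.card_insert_of_notMem (by simp [hab, hac, had]), card_three hbc hbd hcd]

lemma familyMean_cherry {a b c : Fin m} (hab : a ≠ b) (hac : a ≠ c) (hbc : b ≠ c) :
    familyMean P (fun D : Fin n → Finset (Fin m) =>
        adjInd (passiveGraph D) a b * adjInd (passiveGraph D) a c) = cherryP n P := by
  rw [familyMean_adj_mul P hab hac,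
    show ({a, b} ∪ {a, c} : Finset (Fin m)) = {a, b, c} by grind,
    card_three hab hac hbc, cherryP]

lemma familyMean_tri {a b c : Fin m} (hab : a ≠ b) (hac : a ≠ c) (hbc : b ≠ c) :
    familyMean P (fun D : Fin n → Finset (Fin m) => adjInd (passiveGraph D) a b
        * adjInd (passiveGraph D) a c * adjInd (passiveGraph D) b c) = triP n P := by
  rw [familyMean_adj_mul_mul P hab hac hbc,
    show ({a, b} ∪ {a, c} : Finset (Fin m)) = {a, b, c} by grind,
    show ({a, b} ∪ {b, c} : Finset (Fin m)) = {a, b, c} by grind,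
    show ({a, c} ∪ {b, c} : Finset (Fin m)) = {a, b, c} by grind,
    show ({a, b, c} ∪ {b, c} : Finset (Fin m)) = {a, b, c} by grind,
    card_three hab hac hbc, triP]
  ring

lemma familyMean_star {a b c d : Fin m} (hab : a ≠ b) (hac : a ≠ c) (had : a ≠ d) (hbc : b ≠ c)
    (hbd : b ≠ d) (hcd : c ≠ d) :
    familyMean P (fun D : Fin n → Finset (Fin m) => adjInd (passiveGraph D) a b
        * adjInd (passiveGraph D) a c * adjInd (passiveGraph D) a d) = starP n P := by
  rw [familyMean_adj_mul_mul P hab hac had,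
    show ({a, b} ∪ {a, c} : Finset (Fin m)) = {a, b, c} by grind,
    show ({a, b} ∪ {a, d} : Finset (Fin m)) = {a, b, d} by grind,
    show ({a, c} ∪ {a, d} : Finset (Fin m)) = {a, c, d} by grind,
    show ({a, b, c} ∪ {a, d} : Finset (Fin m)) = {a, b, c, d} by grind,
    card_three hab hac hbc, card_three hab had hbd, card_three hac had hcd,
    card_four hab hac had hbc hbd hcd, starP]
  ring

lemma familyMean_path {a b c d : Fin m} (hab : a ≠ b) (hac : a ≠ c) (had : a ≠ d) (hbc : b ≠ c)
    (hbd : b ≠ d) (hcd : c ≠ d) :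
    familyMean P (fun D : Fin n → Finset (Fin m) => adjInd (passiveGraph D) a b
        * adjInd (passiveGraph D) a c * adjInd (passiveGraph D) b d) = pathP n P := by
  rw [familyMean_adj_mul_mul P hab hac hbd,
    show ({a, b} ∪ {a, c} : Finset (Fin m)) = {a, b, c} by grind,
    show ({a, b} ∪ {b, d} : Finset (Fin m)) = {a, b, d} by grind,
    show ({a, c} ∪ {b, d} : Finset (Fin m)) = {a, b, c, d} by grind,
    show ({a, b, c} ∪ {b, d} : Finset (Fin m)) = {a, b, c, d} by grind,
    card_three hab hac hbc, card_three hab had hbd,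
    card_four hab hac had hbc hbd hcd, pathP]
  ring

/-! ### The edge averages in closed form -/

/-- Removes the random pair: the means needed below depend only on which vertices coincide, so they
are the same for every pair v ≠ w. -/
lemma pairMean_eq_of_forall (hm : 2 ≤ m) (f : SimpleGraph (Fin m) → Fin m → Fin m → ℝ) (c : ℝ)
    (h : ∀ v w : Fin m, v ≠ w →
      familyMean P (fun D : Fin n → Finset (Fin m) => f (passiveGraph D) v w) = c) :
    pairMean n P f = c := by
  have h1 : pairMean n P f = (∑ p ∈ (Finset.univ : Finset (Fin m)).offDiag,
      familyMean P (fun D : Fin n → Finset (Fin m) => f (passiveGraph D) p.1 p.2)) /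
        ((m : ℝ) * ((m : ℝ) - 1)) := by
    rw [← familyMean_sum, familyMean, Finset.sum_div]
    exact Finset.sum_congr rfl fun D _ => mul_div_assoc' _ _ _
  have hm' : (2 : ℝ) ≤ m := by exact_mod_cast hm
  have h2 : ((m : ℝ) * ((m : ℝ) - 1)) ≠ 0 := by
    have : (0 : ℝ) < m * (m - 1) := by apply mul_pos <;> linarith
    exact this.ne'
  have h3 : ((Finset.univ : Finset (Fin m)).offDiag.card : ℝ) = (m : ℝ) * ((m : ℝ) - 1) := by
    rw [Finset.offDiag_card, Finset.card_univ, Fintype.card_fin,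
      Nat.cast_sub (Nat.le_mul_self m)]
    push_cast
    ring
  rw [h1, Finset.sum_congr rfl fun p hp => h p.1 p.2 (Finset.mem_offDiag.1 hp).2.2,
    Finset.sum_const, nsmul_eq_mul, h3, mul_div_cancel_left₀ _ h2]

/-- Splitting off two indices from a sum over `Fin m`. -/
lemma sum_eq_of_pair (hm : 2 ≤ m) {v w : Fin m} (hvw : v ≠ w) (f : Fin m → ℝ) {x y z : ℝ}
    (hv : f v = x) (hw : f w = y) (hu : ∀ u, u ≠ v → u ≠ w → f u = z) :
    ∑ u, f u = x + y + ((m : ℝ) - 2) * z := by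
  rw [← Finset.add_sum_erase _ _ (Finset.mem_univ v),
    ← Finset.add_sum_erase (Finset.univ.erase v) f (a := w) (by simp [hvw.symm]),
    Finset.sum_congr rfl (g := fun _ => z), Finset.sum_const, Finset.card_erase_of_mem,
    Finset.card_erase_of_mem, Finset.card_univ, Fintype.card_fin, nsmul_eq_mul, hv, hw,
    Nat.cast_sub (by omega), Nat.cast_sub (by omega)]
  · push_cast; ring
  · simp
  · simp [hvw.symm]
  · intro u hu'
    simp only [Finset.mem_erase, Finset.mem_univ, and_true] at hu'
    exact hu u hu'.2 hu'.1

/-- Splitting off three indices from a sum over `Fin m`. -/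
lemma sum_eq_of_triple (hm : 3 ≤ m) {v w t : Fin m} (hvw : v ≠ w) (hvt : v ≠ t) (hwt : w ≠ t)
    (f : Fin m → ℝ) {x y s z : ℝ} (hv : f v = x) (hw : f w = y) (ht : f t = s)
    (hu : ∀ u, u ≠ v → u ≠ w → u ≠ t → f u = z) :
    ∑ u, f u = x + y + s + ((m : ℝ) - 3) * z := by
  have h := sum_eq_of_pair (by omega) hvw (fun u => f u - if u = t then s - z else 0)
    (x := x) (y := y) (z := z) (by simp [hvt, hv]) (by simp [hwt, hw])
    (fun u h1 h2 => by
      by_cases h3 : u = t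
      · simp [h3, ht]
      · simp [h3, hu u h1 h2 h3])
  rw [Finset.sum_sub_distrib, Finset.sum_ite_eq' Finset.univ t fun _ => s - z] at h
  simp only [Finset.mem_univ, if_true] at h
  linear_combination h

lemma edgeProb_eq (hm : 2 ≤ m) : edgeProb n P = edgeP n P :=
  pairMean_eq_of_forall P hm _ _ fun _ _ h => familyMean_edge P h

lemma familyMean_adj_mul_deg (hm : 2 ≤ m) {v w : Fin m} (h : v ≠ w) :
    familyMean P (fun D : Fin n → Finset (Fin m) =>
        ∑ u, adjInd (passiveGraph D) v w * adjInd (passiveGraph D) v u)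
      = edgeP n P + ((m : ℝ) - 2) * cherryP n P := by
  rw [familyMean_sum, sum_eq_of_pair hm h _ (x := 0) (y := edgeP n P) (z := cherryP n P)]
  · ring
  · simp [adjInd_self, familyMean]
  · simp only [adjInd_mul_self]
    exact familyMean_edge P h
  · intro u h1 h2
    exact familyMean_cherry P h h1.symm h2.symm

lemma pairMean_deg (hm : 2 ≤ m) :
    pairMean n P (fun G v w => deg G v * adjInd G v w)
      = edgeP n P + ((m : ℝ) - 2) * cherryP n P := by
  refine pairMean_eq_of_forall P hm _ _ fun v w h => ?_
  rw [← familyMean_adj_mul_deg P hm h]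
  congr 1
  funext D
  rw [deg_eq_sum, mul_comm, Finset.mul_sum]

/-- With u and t running over neighbours of v, the case u = t = w gives the edge; exactly one of u =
w, t = w, u = t gives a cherry, whence the factor 3; otherwise v is the centre of a three-edge star.
-/
lemma pairMean_deg_sq (hm : 3 ≤ m) :
    pairMean n P (fun G v w => deg G v ^ 2 * adjInd G v w)
      = edgeP n P + 3 * ((m : ℝ) - 2) * cherryP n P
        + ((m : ℝ) - 2) * ((m : ℝ) - 3) * starP n P := by
  refine pairMean_eq_of_forall P (by omega) _ _ fun v w h => ?_
  have h1 : ∀ D : Fin n → Finset (Fin m),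
      deg (passiveGraph D) v ^ 2 * adjInd (passiveGraph D) v w = ∑ u, ∑ t,
        adjInd (passiveGraph D) v w * adjInd (passiveGraph D) v u * adjInd (passiveGraph D) v t := by
    intro D
    rw [deg_eq_sum, mul_comm, sq, Finset.sum_mul_sum, Finset.mul_sum]
    simp only [Finset.mul_sum, mul_assoc]
  simp only [h1]
  rw [familyMean_sum, sum_eq_of_pair (by omega) h _ (x := 0)
    (y := edgeP n P + ((m : ℝ) - 2) * cherryP n P)
    (z := 2 * cherryP n P + ((m : ℝ) - 3) * starP n P)]
  · ring
  · simp [adjInd_self, familyMean]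
  · simp only [adjInd_mul_self]
    exact familyMean_adj_mul_deg P (by omega) h
  · intro u hu1 hu2
    rw [familyMean_sum, sum_eq_of_triple hm h hu1.symm hu2.symm _ (x := 0) (y := cherryP n P)
      (s := cherryP n P) (z := starP n P)]
    · ring
    · simp [adjInd_self, familyMean]
    · rw [← familyMean_cherry P h hu1.symm hu2.symm]
      congr 1
      funext D
      rw [mul_right_comm, adjInd_mul_self]
    · simp only [mul_assoc, adjInd_mul_self]
      exact familyMean_cherry P h hu1.symm hu2.symm
    · intro t ht1 ht2 ht3
      exact familyMean_star P h hu1.symm ht1.symm hu2.symm ht2.symm ht3.symm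

/-- With u a neighbour of v and t a neighbour of w, both u = w and t = v give the edge, exactly one
of them a cherry, u = t a triangle, and the generic case a path with middle edge vw. -/
lemma pairMean_deg_mul_deg (hm : 3 ≤ m) :
    pairMean n P (fun G v w => deg G v * deg G w * adjInd G v w)
      = edgeP n P + 2 * ((m : ℝ) - 2) * cherryP n P + ((m : ℝ) - 2) * triP n P
        + ((m : ℝ) - 2) * ((m : ℝ) - 3) * pathP n P := by
  refine pairMean_eq_of_forall P (by omega) _ _ fun v w h => ?_
  have h1 : ∀ D : Fin n → Finset (Fin m),
      deg (passiveGraph D) v * deg (passiveGraph D) w * adjInd (passiveGraph D) v w = ∑ u, ∑ t,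
        adjInd (passiveGraph D) v w * adjInd (passiveGraph D) v u * adjInd (passiveGraph D) w t := by
    intro D
    rw [deg_eq_sum, deg_eq_sum, mul_comm, Finset.sum_mul_sum, Finset.mul_sum]
    simp only [Finset.mul_sum, mul_assoc]
  simp only [h1]
  rw [familyMean_sum, sum_eq_of_pair (by omega) h _ (x := 0)
    (y := edgeP n P + ((m : ℝ) - 2) * cherryP n P)
    (z := cherryP n P + triP n P + ((m : ℝ) - 3) * pathP n P)]
  · ring
  · simp [adjInd_self, familyMean]
  · simp only [adjInd_mul_self]
    rw [← familyMean_adj_mul_deg P (by omega) h.symm]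
    congr 1
    funext D
    rw [adjInd_comm _ v w]
  · intro u hu1 hu2
    rw [familyMean_sum, sum_eq_of_triple hm h hu1.symm hu2.symm _ (x := cherryP n P) (y := 0)
      (s := triP n P) (z := pathP n P)]
    · ring
    · rw [← familyMean_cherry P h hu1.symm hu2.symm]
      congr 1
      funext D
      rw [adjInd_comm _ w v, mul_right_comm, adjInd_mul_self]
    · simp [adjInd_self, familyMean]
    · exact familyMean_tri P h hu1.symm hu2.symm
    · intro t ht1 ht2 ht3
      exact familyMean_path P h hu1.symm ht1.symm hu2.symm ht2.symm ht3.symm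

/-- The assortativity coefficient in terms of probabilities of small subgraphs. -/
lemma assortativity_eq (hm : 3 ≤ m) (hp : edgeP n P ≠ 0) :
    assortativity n P =
      (((m : ℝ) - 2) * (edgeP n P * triP n P - cherryP n P ^ 2)
        + ((m : ℝ) - 2) * ((m : ℝ) - 3) * (edgeP n P * pathP n P - cherryP n P ^ 2)) /
      (((m : ℝ) - 2) * (edgeP n P * cherryP n P - cherryP n P ^ 2)
        + ((m : ℝ) - 2) * ((m : ℝ) - 3) * (edgeP n P * starP n P - cherryP n P ^ 2)) := by
  rw [assortativity, gMean, bMean, bSqMean, edgeMean, edgeMean, edgeMean, edgeProb_eq P (by omega),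
    pairMean_deg P (by omega), pairMean_deg_sq P hm, pairMean_deg_mul_deg P hm,
    ← mul_div_mul_left (_ - _) (_ - _) (pow_ne_zero 2 hp)]
  congr 1 <;> field_simp <;> ring

end

/-! ### Approximate equality up to a small error -/

/-- `f` agrees with the bounded function `g` up to an error `O(ν)`. -/
structure Near (l : Filter ℕ) (ν f g : ℕ → ℝ) : Prop where
  diff : (fun n => f n - g n) =O[l] ν
  bdd : g =O[l] (fun _ => (1 : ℝ))

namespace Near

variable {l : Filter ℕ} {ν f g f' g' : ℕ → ℝ}

lemma refl (h : f =O[l] (fun _ => (1 : ℝ))) : Near l ν f f :=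
  ⟨by simpa using isBigO_zero ν l, h⟩

lemma const (c : ℝ) : Near l ν (fun _ => c) (fun _ => c) :=
  refl (isBigO_const_const c one_ne_zero l)

lemma congr (h : Near l ν f g) (hf : f =ᶠ[l] f') : Near l ν f' g :=
  ⟨h.diff.congr' (hf.mono fun n hn => by simp [hn]) EventuallyEq.rfl, h.bdd⟩

lemma congr_right (h : Near l ν f g) (hg : ∀ n, g n = g' n) : Near l ν f g' := by
  obtain rfl : g = g' := funext hg
  exact h

lemma bdd_left (hν : Tendsto ν l (𝓝 0)) (h : Near l ν f g) : f =O[l] (fun _ => (1 : ℝ)) := by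
  have := (h.diff.trans (hν.isBigO_one ℝ)).add h.bdd
  simpa using this

lemma add (h : Near l ν f g) (h' : Near l ν f' g') :
    Near l ν (fun n => f n + f' n) (fun n => g n + g' n) :=
  ⟨(h.diff.add h'.diff).congr_left fun n => by ring, h.bdd.add h'.bdd⟩

lemma sub (h : Near l ν f g) (h' : Near l ν f' g') :
    Near l ν (fun n => f n - f' n) (fun n => g n - g' n) :=
  ⟨(h.diff.sub h'.diff).congr_left fun n => by ring, h.bdd.sub h'.bdd⟩

lemma mul (hν : Tendsto ν l (𝓝 0)) (h : Near l ν f g) (h' : Near l ν f' g') :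
    Near l ν (fun n => f n * f' n) (fun n => g n * g' n) := by
  refine ⟨?_, by simpa using h.bdd.mul h'.bdd⟩
  have h1 : (fun n => (f n - g n) * f' n) =O[l] ν := by
    simpa using h.diff.mul (h'.bdd_left hν)
  have h2 : (fun n => g n * (f' n - g' n)) =O[l] ν := by
    simpa using h.bdd.mul h'.diff
  exact (h1.add h2).congr_left fun n => by ring

lemma pow (hν : Tendsto ν l (𝓝 0)) (h : Near l ν f g) (k : ℕ) :
    Near l ν (fun n => f n ^ k) (fun n => g n ^ k) := by
  induction k with
  | zero => simpa using const (1 : ℝ)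
  | succ k ih => simpa only [pow_succ] using ih.mul hν h

lemma tendsto_sub (hν : Tendsto ν l (𝓝 0)) (h : Near l ν f g) :
    Tendsto (fun n => f n - g n) l (𝓝 0) := h.diff.trans_tendsto hν

lemma inv_one (hν : Tendsto ν l (𝓝 0)) (h : Near l ν f fun _ => 1) :
    Near l ν (fun n => (f n)⁻¹) fun _ => 1 := by
  refine ⟨?_, isBigO_refl _ _⟩
  have ht : Tendsto f l (𝓝 1) := by
    simpa using (h.tendsto_sub hν).add_const 1
  have h1 : (fun n => (f n)⁻¹) =O[l] (fun _ => (1 : ℝ)) := (ht.inv₀ one_ne_zero).isBigO_one ℝ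
  have h2 : (fun n => -(f n - 1) * (f n)⁻¹) =O[l] ν := by
    simpa using h.diff.neg_left.mul h1
  refine h2.congr' ?_ EventuallyEq.rfl
  filter_upwards [ht.eventually_ne one_ne_zero] with n hn
  field_simp
  ring

end Near

/-- Peeling off one factor adds nε² to the error and multiplies the old error by at most 1 + |ε|;
the condition n|ε| ≤ 1 absorbs the cubic term, and n² + 2n ≤ (n + 1)² closes the induction. -/
lemma abs_one_add_pow_sub_le (n : ℕ) (ε : ℝ) (h : n * |ε| ≤ 1) :
    |(1 + ε) ^ n - 1 - n * ε| ≤ (n * ε) ^ 2 := by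
  induction n with
  | zero => simp
  | succ n ih =>
    push_cast at h ⊢
    have hε := abs_nonneg ε
    have hn : (0 : ℝ) ≤ n := n.cast_nonneg
    have h1 := ih (by nlinarith)
    have h2 : (1 + ε) ^ (n + 1) - 1 - (n + 1) * ε
        = (1 + ε) * ((1 + ε) ^ n - 1 - n * ε) + n * ε ^ 2 := by ring
    have h3 : |1 + ε| ≤ 1 + |ε| := by
      simpa using abs_add_le 1 ε
    have h4 : n * |ε| ≤ 1 := by nlinarith
    rw [h2]
    calc |(1 + ε) * ((1 + ε) ^ n - 1 - n * ε) + n * ε ^ 2|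
        ≤ |1 + ε| * |(1 + ε) ^ n - 1 - n * ε| + n * ε ^ 2 := by
          refine (abs_add_le _ _).trans ?_
          rw [abs_mul, abs_of_nonneg (by positivity : 0 ≤ (n : ℝ) * ε ^ 2)]
      _ ≤ (1 + |ε|) * (n * ε) ^ 2 + n * ε ^ 2 := by gcongr
      _ = (n ^ 2 + n * (n * |ε|) + n) * ε ^ 2 := by ring
      _ ≤ (n ^ 2 + n * 1 + n) * ε ^ 2 := by gcongr
      _ ≤ ((n + 1) * ε) ^ 2 := by nlinarith [sq_nonneg ε]

/-- First order expansion of `(1 + ε)^n` when `n ε = w z` with `w → 0` and `z` bounded. -/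
lemma isBigO_one_add_pow {l : Filter ℕ} {ε w z : ℕ → ℝ} (hw : Tendsto w l (𝓝 0))
    (hw0 : ∀ᶠ n in l, 0 < w n) (hz : z =O[l] (fun _ => (1 : ℝ)))
    (h : ∀ᶠ n in l, n * ε n = w n * z n) :
    (fun n => ((1 + ε n) ^ n - 1) / w n - z n) =O[l] w := by
  obtain ⟨C, hC⟩ := hz.bound
  have hwC : Tendsto (fun n => w n * C) l (𝓝 0) := by simpa using hw.mul_const C
  refine IsBigO.of_bound (C ^ 2) ?_
  filter_upwards [hC, h, hw0, hwC.eventually_le_const one_pos] with n h1 h2 h3 h4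
  simp only [norm_one, mul_one, Real.norm_eq_abs] at h1 ⊢
  have h5 : n * |ε n| = w n * |z n| := by
    rw [← abs_of_pos h3, ← abs_mul, ← h2, abs_mul, Nat.abs_cast]
  have h6 := abs_one_add_pow_sub_le n (ε n) (by
    rw [h5]; exact (mul_le_mul_of_nonneg_left h1 h3.le).trans h4)
  have h7 : ((1 + ε n) ^ n - 1) / w n - z n = ((1 + ε n) ^ n - 1 - n * ε n) / w n := by
    rw [h2]; field_simp
  rw [h7, abs_div, abs_of_pos h3, div_le_iff₀ h3]
  refine h6.trans ?_
  rw [h2, mul_pow]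
  have : z n ^ 2 ≤ C ^ 2 := sq_le_sq' (by linarith [neg_abs_le (z n)]) ((le_abs_self _).trans h1)
  nlinarith [sq_nonneg (w n)]

/-! ### Algebraic form of the numerator and the denominator -/

/-- Here p = ua and P₃ = (ua)² + uμA²b: two edges from separate sets, or from a common set. The
terms u⁴a⁴ and 2u³μa²A²b occur in p·Tr, p·Pa and P₃² alike and cancel exactly. This is essential,
because the path difference is multiplied by about 1/μ² and u/μ need not be bounded. -/
lemma numerator_identity {u μ : ℝ} (hu : u ≠ 0) (hμ : μ ≠ 0) (a b c₂ c₃ : ℝ) {A p P₃ Tr Pa B E T : ℝ}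
    (hA : A = 1 - u * a) (hB : B = A ^ 2 * (1 + u * μ * b))
    (hT : T = A ^ 3 * (1 + u * μ * (2 * b - μ * c₃))) (hE : E = A ^ 2 * (1 + u * μ * (μ * (c₂ - c₃))))
    (hp : p = 1 - A) (hP₃ : P₃ = 1 - 2 * A + B) (hTr : Tr = 1 - 3 * A + 3 * B - T)
    (hPa : Pa = 1 - 3 * A + 2 * B + E - T) :
    ((1 / μ - 2) * (p * Tr - P₃ ^ 2) + (1 / μ - 2) * (1 / μ - 3) * (p * Pa - P₃ ^ 2)) / u ^ 2
      = (1 - 2 * μ) * (a * A ^ 2 * (b + μ * c₃) - u * μ * a ^ 2 * A ^ 2 * c₃ - μ * A ^ 4 * b ^ 2)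
        + (1 - 2 * μ) * (1 - 3 * μ)
          * (a * A ^ 2 * c₂ - u * a ^ 2 * A ^ 2 * c₃ - A ^ 4 * b ^ 2) := by
  have h1 : p * Tr - P₃ ^ 2 = u ^ 2 * μ * (a * A ^ 2 * (b + μ * c₃) - u * μ * a ^ 2 * A ^ 2 * c₃
      - μ * A ^ 4 * b ^ 2) := by
    subst hP₃ hTr hp hB hT hA
    ring
  have h2 : p * Pa - P₃ ^ 2 = u ^ 2 * μ ^ 2 * (a * A ^ 2 * c₂ - u * a ^ 2 * A ^ 2 * c₃
      - A ^ 4 * b ^ 2) := by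
    subst hP₃ hPa hp hB hT hE hA
    ring
  rw [h1, h2]
  field_simp

/-- Unlike in the numerator, a term of order u/μ survives. Cherries built from two sets give its
part y₂³, and stars with two edges in one set and the third in another give y₂²y₃. -/
lemma denominator_identity {u μ : ℝ} (hu : u ≠ 0) (hμ : μ ≠ 0) (a b c₁ : ℝ) {A p P₃ St B S : ℝ}
    (hA : A = 1 - u * a) (hB : B = A ^ 2 * (1 + u * μ * b))
    (hS : S = A ^ 3 * (1 + u * μ * (3 * b - μ * c₁)))
    (hp : p = 1 - A) (hP₃ : P₃ = 1 - 2 * A + B) (hSt : St = 1 - 3 * A + 3 * B - S) :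
    ((1 / μ - 2) * (p * P₃ - P₃ ^ 2) + (1 / μ - 2) * (1 / μ - 3) * (p * St - P₃ ^ 2)) / u ^ 2
      = u / μ * ((1 - 2 * μ) * (a ^ 2 * (a - u * a ^ 2 - μ * A ^ 2 * b))
          + (1 - 2 * μ) * (1 - 3 * μ) * (a ^ 2 * A ^ 2 * b))
        + ((1 - 2 * μ) * (A ^ 2 * b * (a - u * a ^ 2 - μ * A ^ 2 * b))
          + (1 - 2 * μ) * (1 - 3 * μ) * (a * A ^ 3 * c₁ - A ^ 4 * b ^ 2)) := by
  have h1 : p * P₃ - P₃ ^ 2 = u ^ 2 * ((u * a ^ 2 + μ * A ^ 2 * b)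
      * (a - u * a ^ 2 - μ * A ^ 2 * b)) := by
    subst hP₃ hp hB hA
    ring
  have h2 : p * St - P₃ ^ 2 = u ^ 2 * μ * (u * (a ^ 2 * A ^ 2 * b)
      + μ * (a * A ^ 3 * c₁ - A ^ 4 * b ^ 2)) := by
    subst hP₃ hSt hp hB hS hA
    ring
  rw [h1, h2]
  field_simp
  ring

/-- Quotients of asymptotically equal sequences. -/
lemma tendsto_div_sub_div {l : Filter ℕ} {a a' b b' : ℕ → ℝ} {c : ℝ} (hc : 0 < c)
    (ha : Tendsto (fun n => a n - a' n) l (𝓝 0)) (hb : Tendsto (fun n => b n - b' n) l (𝓝 0))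
    (hb' : ∀ᶠ n in l, c ≤ b' n) (hab : ∀ᶠ n in l, |a' n| ≤ b' n) :
    Tendsto (fun n => a n / b n - a' n / b' n) l (𝓝 0) := by
  have h1 : Tendsto (fun n => (2 / c) * (|a n - a' n| + |b n - b' n|)) l (𝓝 0) := by
    simpa using (ha.abs.add hb.abs).const_mul (2 / c)
  refine squeeze_zero_norm' ?_ h1
  have h2 : ∀ᶠ n in l, |b n - b' n| < c / 2 := by
    have := hb.abs
    rw [abs_zero] at this
    exact this.eventually_lt_const (by positivity)
  filter_upwards [hb', hab, h2] with n h3 h4 h5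
  have h6 : c / 2 ≤ b n := by linarith [(abs_lt.1 h5).1]
  have hb0 : 0 < b n := by linarith
  have hb0' : 0 < b' n := by linarith
  have h7 : a n / b n - a' n / b' n = ((a n - a' n) - (b n - b' n) * (a' n / b' n)) / b n := by
    field_simp
    ring
  have h8 : |a' n / b' n| ≤ 1 := by
    rw [abs_div, abs_of_pos hb0', div_le_one hb0']
    exact h4
  rw [Real.norm_eq_abs, h7, abs_div, abs_of_pos hb0, div_le_iff₀ hb0]
  calc |(a n - a' n) - (b n - b' n) * (a' n / b' n)|
      ≤ |a n - a' n| + |b n - b' n| * |a' n / b' n| := by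
        rw [← abs_mul]; exact abs_sub _ _
    _ ≤ |a n - a' n| + |b n - b' n| := by
        gcongr
        exact mul_le_of_le_one_right (abs_nonneg _) h8
    _ = (2 / c) * (|a n - a' n| + |b n - b' n|) * (c / 2) := by field_simp
    _ ≤ _ := by gcongr

/-- Expansions of the powers that give the probabilities of small subgraphs. -/
lemma exists_expansions {l : Filter ℕ} {μ u q₂ q₃ q₄ y₂ y₃ y₄ Y₂ Y₃ Y₄ : ℕ → ℝ}
    (hμ : Tendsto μ l (𝓝 0)) (hu : Tendsto u l (𝓝 0)) (hμ0 : ∀ᶠ n in l, 0 < μ n)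
    (hu0 : ∀ᶠ n in l, 0 < u n) (hn : ∀ᶠ n in l, n * μ n ^ 2 = u n)
    (hY₂ : Near l (fun n => μ n + u n) Y₂ y₂) (hY₃ : Near l (fun n => μ n + u n) Y₃ y₃)
    (hY₄ : Near l (fun n => μ n + u n) Y₄ y₄)
    (hq₂ : ∀ᶠ n in l, q₂ n = μ n ^ 2 * Y₂ n) (hq₃ : ∀ᶠ n in l, q₃ n = μ n ^ 3 * Y₃ n)
    (hq₄ : ∀ᶠ n in l, q₄ n = μ n ^ 4 * Y₄ n) :
    ∃ a b c₁ c₂ c₃ : ℕ → ℝ, Near l (fun n => μ n + u n) a y₂ ∧ Near l (fun n => μ n + u n) b y₃ ∧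
      Near l (fun n => μ n + u n) c₁ y₄ ∧ Near l (fun n => μ n + u n) c₂ y₄ ∧
      Near l (fun n => μ n + u n) c₃ (fun n => y₂ n ^ 2) ∧
      ∀ᶠ n in l, (1 - q₂ n) ^ n = 1 - u n * a n ∧
        (1 - 2 * q₂ n + q₃ n) ^ n = ((1 - q₂ n) ^ n) ^ 2 * (1 + u n * μ n * b n) ∧
        (1 - 3 * q₂ n + 2 * q₃ n) ^ n
          = ((1 - q₂ n) ^ n) ^ 3 * (1 + u n * μ n * (2 * b n - μ n * c₃ n)) ∧
        (1 - 2 * q₂ n + q₄ n) ^ n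
          = ((1 - q₂ n) ^ n) ^ 2 * (1 + u n * μ n * (μ n * (c₂ n - c₃ n))) ∧
        (1 - 3 * q₂ n + 3 * q₃ n - q₄ n) ^ n
          = ((1 - q₂ n) ^ n) ^ 3 * (1 + u n * μ n * (3 * b n - μ n * c₁ n)) := by
  set ν : ℕ → ℝ := fun n => μ n + u n with hνdef
  have hν : Tendsto ν l (𝓝 0) := by simpa using hμ.add hu
  have hμν : μ =O[l] ν := by
    refine IsBigO.of_bound 1 ?_
    filter_upwards [hμ0, hu0] with n h1 h2
    rw [Real.norm_of_nonneg h1.le, Real.norm_of_nonneg (by simp only [hνdef]; linarith)]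
    simp only [hνdef]; linarith
  have huν : u =O[l] ν := by
    refine IsBigO.of_bound 1 ?_
    filter_upwards [hμ0, hu0] with n h1 h2
    rw [Real.norm_of_nonneg h2.le, Real.norm_of_nonneg (by simp only [hνdef]; linarith)]
    simp only [hνdef]; linarith
  have Nμ : Near l ν μ fun _ => 0 := ⟨by simpa using hμν, isBigO_zero _ _⟩
  -- the inverse of `1 - q₂`
  set ic : ℕ → ℝ := fun n => (1 - μ n ^ 2 * Y₂ n)⁻¹ with hic
  have Nc : Near l ν (fun n => 1 - μ n ^ 2 * Y₂ n) fun _ => 1 :=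
    ((Near.const 1).sub ((Nμ.pow hν 2).mul hν hY₂)).congr_right fun n => by ring
  have Nic : Near l ν ic fun _ => 1 := Nc.inv_one hν
  have hc0 : ∀ᶠ n in l, 1 - μ n ^ 2 * Y₂ n ≠ 0 := by
    have : Tendsto (fun n => 1 - μ n ^ 2 * Y₂ n) l (𝓝 1) := by
      have h := (Nc.tendsto_sub hν).add_const 1
      rw [zero_add] at h
      exact h.congr fun n => by ring
    exact this.eventually_ne one_ne_zero
  set w : ℕ → ℝ := fun n => u n * μ n with hw
  have hwt : Tendsto w l (𝓝 0) := by simpa using hu.mul hμ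
  have hw0 : ∀ᶠ n in l, 0 < w n := by
    filter_upwards [hμ0, hu0] with n h1 h2 using mul_pos h2 h1
  have hwν : w =O[l] ν := by
    simpa using huν.mul (hμ.isBigO_one ℝ)
  -- first order terms
  set zb : ℕ → ℝ := fun n => (Y₃ n - μ n * Y₂ n ^ 2) * ic n ^ 2 with hzb
  set ze : ℕ → ℝ := fun n => μ n * ((Y₄ n - Y₂ n ^ 2) * ic n ^ 2) with hze
  set zt : ℕ → ℝ := fun n => (2 * Y₃ n - 3 * (μ n * Y₂ n ^ 2) + μ n ^ 3 * Y₂ n ^ 3) * ic n ^ 3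
    with hzt
  set zs : ℕ → ℝ := fun n =>
    (3 * Y₃ n - μ n * Y₄ n - 3 * (μ n * Y₂ n ^ 2) + μ n ^ 3 * Y₂ n ^ 3) * ic n ^ 3 with hzs
  have N2 : Near l ν (fun n => Y₂ n ^ 2) fun n => y₂ n ^ 2 := hY₂.pow hν 2
  have N3 : Near l ν (fun n => Y₂ n ^ 3) fun n => y₂ n ^ 3 := hY₂.pow hν 3
  have Nzb : Near l ν zb y₃ :=
    ((hY₃.sub (Nμ.mul hν N2)).mul hν (Nic.pow hν 2)).congr_right fun n => by ring
  have Nze : Near l ν ze fun _ => 0 :=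
    (Nμ.mul hν ((hY₄.sub N2).mul hν (Nic.pow hν 2))).congr_right fun n => by ring
  have Nzt : Near l ν zt fun n => 2 * y₃ n :=
    (((((Near.const 2).mul hν hY₃).sub ((Near.const 3).mul hν (Nμ.mul hν N2))).add
      ((Nμ.pow hν 3).mul hν N3)).mul hν (Nic.pow hν 3)).congr_right fun n => by ring
  have Nzs : Near l ν zs fun n => 3 * y₃ n :=
    ((((((Near.const 3).mul hν hY₃).sub (Nμ.mul hν hY₄)).sub
      ((Near.const 3).mul hν (Nμ.mul hν N2))).add
      ((Nμ.pow hν 3).mul hν N3)).mul hν (Nic.pow hν 3)).congr_right fun n => by ring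
  -- expansions
  have Ea : (fun n => ((1 + -(μ n ^ 2 * Y₂ n)) ^ n - 1) / u n - -Y₂ n) =O[l] u := by
    refine isBigO_one_add_pow hu hu0 (hY₂.bdd_left hν).neg_left ?_
    filter_upwards [hn] with n h1
    rw [← h1]; ring
  have Eb : (fun n => ((1 + w n * zb n / n) ^ n - 1) / w n - zb n) =O[l] w := by
    refine isBigO_one_add_pow hwt hw0 (Nzb.bdd_left hν) ?_
    filter_upwards [hn, hu0] with n h1 h2
    have : (n : ℝ) ≠ 0 := by rintro h; simp [h] at h1; linarith
    field_simp
  have Ee : (fun n => ((1 + w n * ze n / n) ^ n - 1) / w n - ze n) =O[l] w := by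
    refine isBigO_one_add_pow hwt hw0 (Nze.bdd_left hν) ?_
    filter_upwards [hn, hu0] with n h1 h2
    have : (n : ℝ) ≠ 0 := by rintro h; simp [h] at h1; linarith
    field_simp
  have Et : (fun n => ((1 + w n * zt n / n) ^ n - 1) / w n - zt n) =O[l] w := by
    refine isBigO_one_add_pow hwt hw0 (Nzt.bdd_left hν) ?_
    filter_upwards [hn, hu0] with n h1 h2
    have : (n : ℝ) ≠ 0 := by rintro h; simp [h] at h1; linarith
    field_simp
  have Es : (fun n => ((1 + w n * zs n / n) ^ n - 1) / w n - zs n) =O[l] w := by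
    refine isBigO_one_add_pow hwt hw0 (Nzs.bdd_left hν) ?_
    filter_upwards [hn, hu0] with n h1 h2
    have : (n : ℝ) ≠ 0 := by rintro h; simp [h] at h1; linarith
    field_simp
  set b : ℕ → ℝ := fun n => ((1 + w n * zb n / n) ^ n - 1) / w n with hb
  set e : ℕ → ℝ := fun n => ((1 + w n * ze n / n) ^ n - 1) / w n with he
  set t : ℕ → ℝ := fun n => ((1 + w n * zt n / n) ^ n - 1) / w n with ht
  set s : ℕ → ℝ := fun n => ((1 + w n * zs n / n) ^ n - 1) / w n with hs
  -- The expansion errors are O(w) = O(uμ), so dividing a combination of order μ by μ still leaves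
  -- an error O(u).
  have scale : ∀ f z ζ ζ' : ℕ → ℝ, (fun n => f n - z n) =O[l] w → (∀ᶠ n in l, z n = μ n * ζ n) →
      Near l ν ζ ζ' → Near l ν (fun n => f n / μ n) ζ' := by
    intro f z ζ ζ' h1 h2 h3
    refine ⟨?_, h3.bdd⟩
    have h4 : (fun n => (f n - z n) * (μ n)⁻¹) =O[l] u := by
      refine (h1.mul (isBigO_refl (fun n => (μ n)⁻¹) l)).congr' EventuallyEq.rfl ?_
      filter_upwards [hμ0] with n h5
      simp only [hw]
      field_simp
    refine ((h4.trans huν).add h3.diff).congr' ?_ EventuallyEq.rfl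
    filter_upwards [hμ0, h2] with n h5 h6
    rw [h6]
    field_simp
    ring
  -- The witnesses are solved from the five required identities. In each numerator of `c₁`, `c₂`,
  -- `c₃` the leading y₃ terms cancel, which leaves a multiple of μ.
  refine ⟨fun n => -(((1 + -(μ n ^ 2 * Y₂ n)) ^ n - 1) / u n), b,
    fun n => (3 * b n - s n) / μ n, fun n => (e n + 2 * b n - t n) / μ n,
    fun n => (2 * b n - t n) / μ n, ?_, ?_, ?_, ?_, ?_, ?_⟩
  · refine ⟨?_, hY₂.bdd⟩
    exact ((Ea.neg_left.trans huν).add hY₂.diff).congr_left fun n => by ring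
  · exact ⟨((Eb.trans hwν).add Nzb.diff).congr_left fun n => by ring, Nzb.bdd⟩
  · refine scale _ (fun n => 3 * zb n - zs n)
      (fun n => (Y₄ n - 3 * (μ n * (Y₂ n * Y₃ n)) + 2 * (μ n ^ 2 * Y₂ n ^ 3)) * ic n ^ 3) _
      (((Eb.const_mul_left 3).sub Es).congr_left fun n => by ring) ?_ ?_
    · filter_upwards [hc0] with n h1
      simp only [hzb, hzs, hic]
      field_simp
      ring
    · exact (((hY₄.sub ((Near.const 3).mul hν (Nμ.mul hν (hY₂.mul hν hY₃)))).add
        ((Near.const 2).mul hν ((Nμ.pow hν 2).mul hν N3))).mul hν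
        (Nic.pow hν 3)).congr_right fun n => by ring
  · refine scale _ (fun n => ze n + 2 * zb n - zt n)
      (fun n => (Y₄ n - μ n ^ 2 * (Y₂ n * Y₄ n) + 2 * (μ n ^ 2 * Y₂ n ^ 3)
        - 2 * (μ n * (Y₂ n * Y₃ n))) * ic n ^ 3) _
      (((Ee.add (Eb.const_mul_left 2)).sub Et).congr_left fun n => by ring) ?_ ?_
    · filter_upwards [hc0] with n h1
      simp only [hzb, hze, hzt, hic]
      field_simp
      ring
    · exact ((((hY₄.sub ((Nμ.pow hν 2).mul hν (hY₂.mul hν hY₄))).add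
        ((Near.const 2).mul hν ((Nμ.pow hν 2).mul hν N3))).sub
        ((Near.const 2).mul hν (Nμ.mul hν (hY₂.mul hν hY₃)))).mul hν
        (Nic.pow hν 3)).congr_right fun n => by ring
  · refine scale _ (fun n => 2 * zb n - zt n)
      (fun n => (Y₂ n ^ 2 - 2 * (μ n * (Y₂ n * Y₃ n)) + μ n ^ 2 * Y₂ n ^ 3) * ic n ^ 3) _
      (((Eb.const_mul_left 2).sub Et).congr_left fun n => by ring) ?_ ?_
    · filter_upwards [hc0] with n h1
      simp only [hzb, hzt, hic]
      field_simp
      ring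
    · exact (((N2.sub ((Near.const 2).mul hν (Nμ.mul hν (hY₂.mul hν hY₃)))).add
        ((Nμ.pow hν 2).mul hν N3)).mul hν (Nic.pow hν 3)).congr_right fun n => by ring
  · filter_upwards [hq₂, hq₃, hq₄, hc0, hμ0, hu0, hn] with n h2 h3 h4 hc hμn hun hnn
    have hn0 : (n : ℝ) ≠ 0 := by rintro h; simp [h] at hnn; linarith
    have hwn : u n * μ n ≠ 0 := (mul_pos hun hμn).ne'
    -- As nμ² = u, the bases are 1 + μ³z. By the choice of `zb`, `ze`, `zt`, `zs` these are exactly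
    -- the quotients of the original bases by powers of 1 - q₂.
    have hwz : ∀ z : ℝ, w n * z / n = μ n ^ 3 * z := by
      intro z
      simp only [hw]
      rw [← hnn]
      field_simp
    refine ⟨?_, ?_, ?_, ?_, ?_⟩
    · rw [h2]
      field_simp
      ring
    · have h5 : 1 + u n * μ n * b n = (1 + μ n ^ 3 * zb n) ^ n := by
        simp only [hb, hwz]
        simp only [hw]
        field_simp
        ring
      rw [h5, h2, h3, ← pow_mul, mul_comm n, pow_mul, ← mul_pow]
      congr 1
      simp only [hzb, hic]
      field_simp
      ring
    · have h5 : 1 + u n * μ n * (2 * b n - μ n * ((2 * b n - t n) / μ n))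
          = (1 + μ n ^ 3 * zt n) ^ n := by
        simp only [ht, hwz]
        simp only [hw]
        field_simp
        ring
      rw [h5, h2, h3, ← pow_mul, mul_comm n, pow_mul, ← mul_pow]
      congr 1
      simp only [hzt, hic]
      field_simp
      ring
    · have h5 : 1 + u n * μ n * (μ n * ((e n + 2 * b n - t n) / μ n - (2 * b n - t n) / μ n))
          = (1 + μ n ^ 3 * ze n) ^ n := by
        simp only [he, hwz]
        simp only [hw]
        field_simp
        ring
      rw [h5, h2, h4, ← pow_mul, mul_comm n, pow_mul, ← mul_pow]
      congr 1
      simp only [hze, hic]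
      field_simp
      ring
    · have h5 : 1 + u n * μ n * (3 * b n - μ n * ((3 * b n - s n) / μ n))
          = (1 + μ n ^ 3 * zs n) ^ n := by
        simp only [hs, hwz]
        simp only [hw]
        field_simp
        ring
      rw [h5, h2, h3, h4, ← pow_mul, mul_comm n, pow_mul, ← mul_pow]
      congr 1
      simp only [hzs, hic]
      field_simp
      ring

/-- If the mean degree is not too large, the assortativity coefficient is asymptotically equal
to a rational function of the factorial moments of the set size. -/
lemma tendsto_assortativity_sub_assortFormula {l : Filter ℕ} {m : ℕ → ℕ}
    {P : ∀ n, PMF (Fin (m n + 1))} (hm : Tendsto m l atTop)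
    (hy : ∀ i ∈ Finset.Icc 2 4, (fun n => sizeFactMoment (P n) i) =O[l] fun _ => (1 : ℝ))
    {c : ℝ} (hc : 0 < c) (hy₂ : ∀ᶠ n in l, c ≤ sizeFactMoment (P n) 2)
    (hV : ∀ᶠ n in l, 0 ≤ sizeFactMoment (P n) 2 * sizeFactMoment (P n) 4
      + sizeFactMoment (P n) 2 * sizeFactMoment (P n) 3 - sizeFactMoment (P n) 3 ^ 2)
    (hn : ∀ᶠ n : ℕ in l, 0 < n)
    (hu : Tendsto (fun n : ℕ => (n : ℝ) / (m n : ℝ) ^ 2) l (𝓝 0))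
    (hκ : Tendsto (fun n : ℕ => (1 / (m n : ℝ) + n / (m n : ℝ) ^ 2) / (n / m n)) l (𝓝 0)) :
    Tendsto (fun n : ℕ => assortativity n (P n) - assortFormula (P n) ((m n : ℝ) / n)) l (𝓝 0) := by
  set μ : ℕ → ℝ := fun n => 1 / (m n : ℝ) with hμdef
  set u : ℕ → ℝ := fun n => (n : ℝ) / (m n : ℝ) ^ 2 with hudef
  set ν : ℕ → ℝ := fun n => μ n + u n with hνdef
  set y₂ : ℕ → ℝ := fun n => sizeFactMoment (P n) 2
  set y₃ : ℕ → ℝ := fun n => sizeFactMoment (P n) 3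
  set y₄ : ℕ → ℝ := fun n => sizeFactMoment (P n) 4
  have hmR : Tendsto (fun n => (m n : ℝ)) l atTop := tendsto_natCast_atTop_atTop.comp hm
  have hm4 : ∀ᶠ n in l, 4 ≤ m n := hm.eventually_ge_atTop 4
  have hμ : Tendsto μ l (𝓝 0) := by
    exact (tendsto_inv_atTop_zero.comp hmR).congr fun n => (one_div _).symm
  have hμ0 : ∀ᶠ n in l, 0 < μ n := by
    filter_upwards [hm4] with n h
    have : (0 : ℝ) < m n := by exact_mod_cast (by omega : 0 < m n)
    simp only [hμdef]; positivity
  have hu0 : ∀ᶠ n in l, 0 < u n := by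
    filter_upwards [hm4, hn] with n h h'
    have h1 : (0 : ℝ) < m n := by exact_mod_cast (by omega : 0 < m n)
    have h2 : (0 : ℝ) < n := by exact_mod_cast h'
    simp only [hudef]; positivity
  have hν : Tendsto ν l (𝓝 0) := by simpa using hμ.add hu
  have hμν : μ =O[l] ν := by
    refine IsBigO.of_bound 1 ?_
    filter_upwards [hμ0, hu0] with n h1 h2
    rw [Real.norm_of_nonneg h1.le, Real.norm_of_nonneg (by simp only [hνdef]; linarith)]
    simp only [hνdef]; linarith
  have huν : u =O[l] ν := by
    refine IsBigO.of_bound 1 ?_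
    filter_upwards [hμ0, hu0] with n h1 h2
    rw [Real.norm_of_nonneg h2.le, Real.norm_of_nonneg (by simp only [hνdef]; linarith)]
    simp only [hνdef]; linarith
  have Nμ : Near l ν μ fun _ => 0 := ⟨by simpa using hμν, isBigO_zero _ _⟩
  have Nu : Near l ν u fun _ => 0 := ⟨by simpa using huν, isBigO_zero _ _⟩
  have Ny₂ : Near l ν y₂ y₂ := .refl (hy 2 (by simp))
  have Ny₃ : Near l ν y₃ y₃ := .refl (hy 3 (by simp))
  have Ny₄ : Near l ν y₄ y₄ := .refl (hy 4 (by simp))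
  have N1 : Near l ν (fun n => 1 - μ n) fun _ => 1 :=
    ((Near.const 1).sub Nμ).congr_right fun n => by ring
  have N2 : Near l ν (fun n => 1 - 2 * μ n) fun _ => 1 :=
    ((Near.const 1).sub ((Near.const 2).mul hν Nμ)).congr_right fun n => by ring
  have N3 : Near l ν (fun n => 1 - 3 * μ n) fun _ => 1 :=
    ((Near.const 1).sub ((Near.const 3).mul hν Nμ)).congr_right fun n => by ring
  -- The factors in `Y₂`, `Y₃`, `Y₄` come from (m)_j = m^j (1 - μ)⋯(1 - (j - 1)μ).
  obtain ⟨a, b, c₁, c₂, c₃, Na, Nb, Nc₁, Nc₂, Nc₃, hexp⟩ := exists_expansions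
    (q₂ := fun n => covProb (P n) 2) (q₃ := fun n => covProb (P n) 3)
    (q₄ := fun n => covProb (P n) 4) (y₂ := y₂) (y₃ := y₃) (y₄ := y₄)
    (Y₂ := fun n => y₂ n * (1 - μ n)⁻¹)
    (Y₃ := fun n => y₃ n * (1 - μ n)⁻¹ * (1 - 2 * μ n)⁻¹)
    (Y₄ := fun n => y₄ n * (1 - μ n)⁻¹ * (1 - 2 * μ n)⁻¹ * (1 - 3 * μ n)⁻¹)
    hμ hu hμ0 hu0 (Eventually.of_forall fun n => by simp only [hμdef, hudef]; ring)
    ((Ny₂.mul hν (N1.inv_one hν)).congr_right fun n => by ring)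
    (((Ny₃.mul hν (N1.inv_one hν)).mul hν (N2.inv_one hν)).congr_right fun n => by ring)
    ((((Ny₄.mul hν (N1.inv_one hν)).mul hν (N2.inv_one hν)).mul hν
      (N3.inv_one hν)).congr_right fun n => by ring)
    (by
      filter_upwards [hm4] with n h
      have h1 : (4 : ℝ) ≤ m n := by exact_mod_cast h
      have h2 : (m n : ℝ) - 1 ≠ 0 := by linarith
      have h3 : (m n : ℝ) ≠ 0 := by linarith
      simp only [covProb, hμdef, Nat.descFactorial_succ, Nat.descFactorial_zero, mul_one, Nat.sub_zero]
      rw [Nat.cast_mul, Nat.cast_sub (by omega)]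
      push_cast
      field_simp
      simp only [y₂])
    (by
      filter_upwards [hm4] with n h
      have h1 : (4 : ℝ) ≤ m n := by exact_mod_cast h
      have h2 : (m n : ℝ) - 1 ≠ 0 := by linarith
      have h2' : (m n : ℝ) - 2 ≠ 0 := by linarith
      have h3 : (m n : ℝ) ≠ 0 := by linarith
      simp only [covProb, hμdef, Nat.descFactorial_succ, Nat.descFactorial_zero, mul_one, Nat.sub_zero]
      rw [Nat.cast_mul, Nat.cast_mul, Nat.cast_sub (by omega), Nat.cast_sub (by omega)]
      push_cast
      field_simp
      simp only [y₃])
    (by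
      filter_upwards [hm4] with n h
      have h1 : (4 : ℝ) ≤ m n := by exact_mod_cast h
      have h2 : (m n : ℝ) - 1 ≠ 0 := by linarith
      have h2' : (m n : ℝ) - 2 ≠ 0 := by linarith
      have h2'' : (m n : ℝ) - 3 ≠ 0 := by linarith
      have h3 : (m n : ℝ) ≠ 0 := by linarith
      simp only [covProb, hμdef, Nat.descFactorial_succ, Nat.descFactorial_zero, mul_one, Nat.sub_zero]
      rw [Nat.cast_mul, Nat.cast_mul, Nat.cast_mul, Nat.cast_sub (by omega),
        Nat.cast_sub (by omega), Nat.cast_sub (by omega)]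
      push_cast
      field_simp
      simp only [y₄])
  set A : ℕ → ℝ := fun n => 1 - u n * a n with hA
  have NA : Near l ν A fun _ => 1 :=
    ((Near.const 1).sub (Nu.mul hν Na)).congr_right fun n => by ring
  -- the scaled numerator and denominator
  set G : ℕ → ℝ := fun n =>
    (1 - 2 * μ n) * (a n * A n ^ 2 * (b n + μ n * c₃ n) - u n * μ n * a n ^ 2 * A n ^ 2 * c₃ n
        - μ n * A n ^ 4 * b n ^ 2)
      + (1 - 2 * μ n) * (1 - 3 * μ n)
        * (a n * A n ^ 2 * c₂ n - u n * a n ^ 2 * A n ^ 2 * c₃ n - A n ^ 4 * b n ^ 2) with hG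
  set H₁ : ℕ → ℝ := fun n =>
    (1 - 2 * μ n) * (a n ^ 2 * (a n - u n * a n ^ 2 - μ n * A n ^ 2 * b n))
          + (1 - 2 * μ n) * (1 - 3 * μ n) * (a n ^ 2 * A n ^ 2 * b n) with hH₁
  set H₀ : ℕ → ℝ := fun n =>
    (1 - 2 * μ n) * (A n ^ 2 * b n * (a n - u n * a n ^ 2 - μ n * A n ^ 2 * b n))
          + (1 - 2 * μ n) * (1 - 3 * μ n) * (a n * A n ^ 3 * c₁ n - A n ^ 4 * b n ^ 2) with hH₀
  set V : ℕ → ℝ := fun n => y₂ n * y₄ n + y₂ n * y₃ n - y₃ n ^ 2 with hVdef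
  set U : ℕ → ℝ := fun n => y₂ n ^ 2 * (y₂ n + y₃ n) with hUdef
  have NG : Near l ν G V := by
    refine ((N2.mul hν ((((Na.mul hν (NA.pow hν 2)).mul hν (Nb.add (Nμ.mul hν Nc₃))).sub
      ((((Nu.mul hν Nμ).mul hν (Na.pow hν 2)).mul hν (NA.pow hν 2)).mul hν Nc₃)).sub
      ((Nμ.mul hν (NA.pow hν 4)).mul hν (Nb.pow hν 2)))).add
      ((N2.mul hν N3).mul hν ((((Na.mul hν (NA.pow hν 2)).mul hν Nc₂).sub
      (((Nu.mul hν (Na.pow hν 2)).mul hν (NA.pow hν 2)).mul hν Nc₃)).sub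
      ((NA.pow hν 4).mul hν (Nb.pow hν 2))))).congr_right fun n => ?_
    simp only [hVdef]
    ring
  have Nin : Near l ν (fun n => a n - u n * a n ^ 2 - μ n * A n ^ 2 * b n) y₂ :=
    ((Na.sub (Nu.mul hν (Na.pow hν 2))).sub
      ((Nμ.mul hν (NA.pow hν 2)).mul hν Nb)).congr_right fun n => by ring
  have NH₁ : Near l ν H₁ U := by
    refine ((N2.mul hν ((Na.pow hν 2).mul hν Nin)).add ((N2.mul hν N3).mul hν
      (((Na.pow hν 2).mul hν (NA.pow hν 2)).mul hν Nb))).congr_right fun n => ?_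
    simp only [hUdef]
    ring
  have NH₀ : Near l ν H₀ V := by
    refine ((N2.mul hν (((NA.pow hν 2).mul hν Nb).mul hν Nin)).add ((N2.mul hν N3).mul hν
      (((Na.mul hν (NA.pow hν 3)).mul hν Nc₁).sub
        ((NA.pow hν 4).mul hν (Nb.pow hν 2))))).congr_right fun n => ?_
    simp only [hVdef]
    ring
  have hy₃ : ∀ n, 0 ≤ y₃ n := fun n => Finset.sum_nonneg fun k _ => by positivity
  have hκ' : Tendsto (fun n : ℕ => ν n * (n / m n : ℝ)⁻¹) l (𝓝 0) :=
    hκ.congr fun n => div_eq_mul_inv _ _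
  -- Both quotients are compared after division by κ = n/m. The denominator U + V/κ is then at least
  -- U ≥ c³ and dominates V/κ, even if V and κ both vanish in the limit.
  have key := tendsto_div_sub_div (l := l) (c := c ^ 3) (by positivity)
    (a := fun n => G n / (n / m n)) (a' := fun n => V n / (n / m n))
    (b := fun n => H₁ n + H₀ n / (n / m n)) (b' := fun n => U n + V n / (n / m n))
    (by
      have : (fun n => (G n - V n) * (n / m n : ℝ)⁻¹) =O[l] fun n => ν n * (n / m n : ℝ)⁻¹ :=
        NG.diff.mul (isBigO_refl _ _)
      refine (this.trans_tendsto hκ').congr fun n => ?_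
      ring)
    (by
      have : (fun n => (H₀ n - V n) * (n / m n : ℝ)⁻¹) =O[l] fun n => ν n * (n / m n : ℝ)⁻¹ :=
        NH₀.diff.mul (isBigO_refl _ _)
      have h1 := this.trans_tendsto hκ'
      have h2 := (NH₁.tendsto_sub hν).add h1
      rw [add_zero] at h2
      refine h2.congr fun n => ?_
      ring)
    (by
      filter_upwards [hy₂, hV] with n h1 h2
      have h3 := hy₃ n
      have h1' : c ≤ y₂ n := h1
      have h4 : c ^ 2 * c ≤ y₂ n ^ 2 * (y₂ n + y₃ n) := by gcongr; linarith
      have h5 : 0 ≤ V n / (n / m n) := div_nonneg h2 (by positivity)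
      simp only [hUdef]
      linarith [pow_succ c 2])
    (by
      filter_upwards [hy₂, hV] with n h1 h2
      have h3 := hy₃ n
      have h1' : c ≤ y₂ n := h1
      have h4 : 0 ≤ y₂ n ^ 2 * (y₂ n + y₃ n) := by
        apply mul_nonneg (sq_nonneg _); linarith
      have h5 : 0 ≤ V n / (n / m n) := div_nonneg h2 (by positivity)
      rw [abs_of_nonneg h5]
      simp only [hUdef]
      linarith)
  refine key.congr' ?_
  -- Positivity of `a` makes the edge probability ua nonzero, as `assortativity_eq` requires.
  have ha0 : ∀ᶠ n in l, 0 < a n := by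
    have h1 := Na.tendsto_sub hν
    have h2 := (tendsto_order.1 h1).1 (-(c / 2)) (by linarith)
    filter_upwards [h2, hy₂] with n h3 h4
    have h4' : c ≤ y₂ n := h4
    linarith
  filter_upwards [hexp, hm4, hn, hμ0, hu0, ha0] with n ⟨e1, e2, e3, e4, e5⟩ hmn hnn hμn hun han
  have hm0 : (0 : ℝ) < m n := by exact_mod_cast (by omega : 0 < m n)
  have hn0 : (0 : ℝ) < n := by exact_mod_cast hnn
  have hp : edgeP n (P n) = u n * a n := by rw [edgeP, e1]; ring
  have hp0 : edgeP n (P n) ≠ 0 := by rw [hp]; positivity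
  have hmμ : (m n : ℝ) = 1 / μ n := by simp [hμdef]
  have hκμ : (n : ℝ) / m n = u n / μ n := by simp only [hudef, hμdef]; field_simp
  have hnum := numerator_identity hun.ne' hμn.ne' (a n) (b n) (c₂ n) (c₃ n)
    (A := (1 - covProb (P n) 2) ^ n) (p := edgeP n (P n)) (P₃ := cherryP n (P n))
    (Tr := triP n (P n)) (Pa := pathP n (P n)) e1 e2 e3 e4 rfl rfl rfl rfl
  have hden := denominator_identity hun.ne' hμn.ne' (a n) (b n) (c₁ n)
    (A := (1 - covProb (P n) 2) ^ n) (p := edgeP n (P n)) (P₃ := cherryP n (P n))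
    (St := starP n (P n)) e1 e2 e5 rfl rfl rfl
  rw [← hmμ, e1, ← hκμ] at hden
  rw [← hmμ, e1] at hnum
  have hG' : G n = (((m n : ℝ) - 2) * (edgeP n (P n) * triP n (P n) - cherryP n (P n) ^ 2)
        + ((m n : ℝ) - 2) * ((m n : ℝ) - 3)
          * (edgeP n (P n) * pathP n (P n) - cherryP n (P n) ^ 2)) / u n ^ 2 := by
    rw [hnum]
  have hH' : n / m n * H₁ n + H₀ n
      = (((m n : ℝ) - 2) * (edgeP n (P n) * cherryP n (P n) - cherryP n (P n) ^ 2)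
        + ((m n : ℝ) - 2) * ((m n : ℝ) - 3)
          * (edgeP n (P n) * starP n (P n) - cherryP n (P n) ^ 2)) / u n ^ 2 := by
    rw [hden]
  have hκ0 : (0 : ℝ) < n / m n := by positivity
  congr 1
  · have h1 := assortativity_eq (n := n) (P n) (by omega) hp0
    rw [← div_div_div_cancel_right₀ (pow_ne_zero 2 hun.ne'), ← hG', ← hH',
      ← div_div_div_cancel_right₀ hκ0.ne' (G n) _] at h1
    rw [h1]
    congr 1
    rw [add_div ((n : ℝ) / m n * H₁ n) (H₀ n), mul_div_cancel_left₀ _ hκ0.ne']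
  · have : assortFormula (P n) ((m n : ℝ) / n) = V n / (V n + n / m n * U n) := by
      simp only [assortFormula, inv_div, hVdef, hUdef, y₂, y₃, y₄, mul_assoc]
    rw [this, ← div_div_div_cancel_right₀ hκ0.ne' (V n) (V n + _)]
    congr 1
    rw [add_div (V n) ((n : ℝ) / m n * U n), mul_div_cancel_left₀ _ hκ0.ne', add_comm]

/-! ### Convergence of factorial moments -/

/-- The size law as a sequence of real numbers. -/
def sizeLaw {m : ℕ} (P : PMF (Fin (m + 1))) (j : ℕ) : ℝ :=
  if h : j < m + 1 then (P ⟨j, h⟩).toReal else 0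

lemma sizeLaw_nonneg {m : ℕ} (P : PMF (Fin (m + 1))) (j : ℕ) : 0 ≤ sizeLaw P j := by
  rw [sizeLaw]
  split_ifs <;> simp

lemma hasSum_sizeLaw {m : ℕ} (P : PMF (Fin (m + 1))) (f : ℕ → ℝ) :
    HasSum (fun j => sizeLaw P j * f j) (∑ k : Fin (m + 1), (P k).toReal * f k) := by
  have h1 : ∑ k : Fin (m + 1), (P k).toReal * f k
      = ∑ j ∈ Finset.range (m + 1), sizeLaw P j * f j := by
    rw [← Fin.sum_univ_eq_sum_range (fun j => sizeLaw P j * f j)]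
    refine Finset.sum_congr rfl fun k _ => ?_
    rw [sizeLaw, dif_pos k.2]
  rw [h1]
  refine hasSum_sum_of_ne_finset_zero fun j hj => ?_
  rw [sizeLaw, dif_neg (by simpa using hj), zero_mul]

lemma toMeasure_preimage_singleton {m : ℕ} (P : PMF (Fin (m + 1))) (j : ℕ) :
    (P.toMeasure ((fun k : Fin (m + 1) => (k : ℕ)) ⁻¹' {j})).toReal = sizeLaw P j := by
  rw [sizeLaw]
  split_ifs with h
  · have : (fun k : Fin (m + 1) => (k : ℕ)) ⁻¹' {j} = {⟨j, h⟩} := by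
      ext k
      simp [Fin.ext_iff]
    rw [this, P.toMeasure_apply_singleton _ (MeasurableSet.singleton _)]
  · have : (fun k : Fin (m + 1) => (k : ℕ)) ⁻¹' {j} = ∅ := by
      ext k
      have := k.2
      simp only [Set.mem_preimage, Set.mem_singleton_iff, Set.mem_empty_iff_false, iff_false]
      omega
    simp [this]

lemma tendsto_sizeLaw {m : ℕ → ℕ} {P : ∀ n, PMF (Fin (m n + 1))} {Q : PMF ℕ}
    (h : TendstoInDistribution (fun (n : ℕ) (k : Fin (m n + 1)) => (k : ℕ)) atTop
      (id : ℕ → ℕ) (fun n => (P n).toMeasure) Q.toMeasure) (j : ℕ) :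
    Tendsto (fun n => sizeLaw (P n) j) atTop (𝓝 (Q j).toReal) := by
  -- Singletons of the discrete space ℕ have empty frontier, so the portmanteau theorem gives
  -- convergence of point masses.
  have h1 := ProbabilityMeasure.tendsto_measure_of_null_frontier_of_tendsto' h.tendsto
    (E := {j}) (by simp)
  simp only [ProbabilityMeasure.coe_mk] at h1
  have hQ : (Q.toMeasure.map (id : ℕ → ℕ)) {j} = Q j := by
    rw [Measure.map_id, Q.toMeasure_apply_singleton _ (MeasurableSet.singleton _)]
  have h2 := (ENNReal.tendsto_toReal (measure_ne_top _ _)).comp h1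
  rw [hQ] at h2
  refine h2.congr fun n => ?_
  rw [Function.comp_apply, Measure.map_apply_of_aemeasurable (h.forall_aemeasurable n)
    (MeasurableSet.singleton _), toMeasure_preimage_singleton]

/-- Scheffé's lemma for sums: if nonnegative weights converge pointwise and their `w`-moments
converge, so do the `f`-moments for all `f` dominated by `w`. -/
lemma tendsto_tsum_of_dominated_moment {a : ℕ → ℕ → ℝ} {b w f : ℕ → ℝ} (ha : ∀ n k, 0 ≤ a n k)
    (hb : ∀ k, 0 ≤ b k) (hf : ∀ k, |f k| ≤ w k)
    (hab : ∀ k, Tendsto (fun n => a n k) atTop (𝓝 (b k)))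
    (hsa : ∀ n, Summable fun k => a n k * w k) (hsb : Summable fun k => b k * w k)
    (hlim : Tendsto (fun n => ∑' k, a n k * w k) atTop (𝓝 (∑' k, b k * w k))) :
    Tendsto (fun n => ∑' k, a n k * f k) atTop (𝓝 (∑' k, b k * f k)) := by
  have hw : ∀ k, 0 ≤ w k := fun k => (abs_nonneg _).trans (hf k)
  have hmin : ∀ n k, 0 ≤ min (a n k * w k) (b k * w k) := fun n k =>
    le_min (mul_nonneg (ha n k) (hw k)) (mul_nonneg (hb k) (hw k))
  have hsmin : ∀ n, Summable fun k => min (a n k * w k) (b k * w k) := fun n =>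
    Summable.of_nonneg_of_le (hmin n) (fun k => min_le_right _ _) hsb
  -- The weighted terms need not have a summable majorant, but their minima with the limit terms do.
  -- Then |x - y| = x + y - 2 min(x, y) turns convergence of the sums into convergence in ℓ¹.
  have h1 : Tendsto (fun n => ∑' k, min (a n k * w k) (b k * w k)) atTop
      (𝓝 (∑' k, b k * w k)) := by
    refine tendsto_tsum_of_dominated_convergence hsb (fun k => ?_)
      (Eventually.of_forall fun n k => ?_)
    · have := ((hab k).mul_const (w k)).min (tendsto_const_nhds (x := b k * w k))
      rwa [min_self] at this
    · rw [Real.norm_of_nonneg (hmin n k)]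
      exact min_le_right _ _
  have h2 : ∀ n k, |a n k - b k| * w k
      = a n k * w k + b k * w k - 2 * min (a n k * w k) (b k * w k) := by
    intro n k
    rw [← abs_of_nonneg (hw k), ← abs_mul, abs_of_nonneg (hw k), sub_mul]
    rcases le_total (a n k * w k) (b k * w k) with h | h
    · rw [min_eq_left h, abs_of_nonpos (by linarith)]; ring
    · rw [min_eq_right h, abs_of_nonneg (by linarith)]; ring
  have hsabs : ∀ n, Summable fun k => |a n k - b k| * w k := by
    intro n
    simp only [h2]
    exact ((hsa n).add hsb).sub ((hsmin n).mul_left 2)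
  have h3 : Tendsto (fun n => ∑' k, |a n k - b k| * w k) atTop (𝓝 0) := by
    have h4 : ∀ n, ∑' k, |a n k - b k| * w k = ∑' k, a n k * w k + ∑' k, b k * w k
        - 2 * ∑' k, min (a n k * w k) (b k * w k) := by
      intro n
      simp only [h2]
      rw [((hsa n).add hsb).tsum_sub ((hsmin n).mul_left 2), (hsa n).tsum_add hsb, tsum_mul_left]
    simp only [h4]
    have := (hlim.add_const (∑' k, b k * w k)).sub (h1.const_mul 2)
    refine this.trans_eq ?_
    congr 1
    ring
  have hsaf : ∀ n, Summable fun k => a n k * f k := fun n =>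
    Summable.of_norm_bounded (hsa n) fun k => by
      rw [norm_mul, Real.norm_of_nonneg (ha n k), Real.norm_eq_abs]
      exact mul_le_mul_of_nonneg_left (hf k) (ha n k)
  have hsbf : Summable fun k => b k * f k :=
    Summable.of_norm_bounded hsb fun k => by
      rw [norm_mul, Real.norm_of_nonneg (hb k), Real.norm_eq_abs]
      exact mul_le_mul_of_nonneg_left (hf k) (hb k)
  rw [tendsto_iff_norm_sub_tendsto_zero]
  refine squeeze_zero (fun n => norm_nonneg _) (fun n => ?_) h3
  rw [← (hsaf n).tsum_sub hsbf]
  refine tsum_of_norm_bounded (hsabs n).hasSum fun k => ?_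
  rw [← sub_mul, norm_mul, Real.norm_eq_abs, Real.norm_eq_abs]
  exact mul_le_mul_of_nonneg_left (hf k) (abs_nonneg _)

/-- The expectation of `f` under the law `Q`, with values in `[0, ∞]`. -/
def emean (Q : PMF ℕ) (f : ℕ → ℕ) : ENNReal := ∑' k : ℕ, Q k * (f k : ENNReal)

lemma emean_toReal (Q : PMF ℕ) (f : ℕ → ℕ) :
    (emean Q f).toReal = ∑' k : ℕ, (Q k).toReal * (f k : ℝ) := by
  rw [emean, ENNReal.tsum_toReal_eq fun k => ENNReal.mul_ne_top (Q.apply_ne_top k) (by simp)]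
  simp

lemma hasSum_emean {Q : PMF ℕ} {f : ℕ → ℕ} (h : emean Q f ≠ ⊤) :
    HasSum (fun k : ℕ => (Q k).toReal * (f k : ℝ)) (emean Q f).toReal := by
  have := ENNReal.summable_toReal h
  simp only [ENNReal.toReal_mul, ENNReal.toReal_natCast] at this
  rw [emean_toReal]
  exact this.hasSum

lemma emean_mono (Q : PMF ℕ) {f g : ℕ → ℕ} (h : ∀ k, f k ≤ g k) : emean Q f ≤ emean Q g :=
  ENNReal.tsum_le_tsum fun k => mul_le_mul_right (by exact_mod_cast h k) _

lemma lintegral_pow (Q : PMF ℕ) (i : ℕ) :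
    ∫⁻ k : ℕ, ENNReal.ofReal ((k : ℝ) ^ i) ∂Q.toMeasure = emean Q fun k => k ^ i := by
  rw [lintegral_countable', emean]
  refine tsum_congr fun k => ?_
  rw [Q.toMeasure_apply_singleton _ (MeasurableSet.singleton _), mul_comm,
    ENNReal.ofReal_pow (Nat.cast_nonneg k), ENNReal.ofReal_natCast]
  push_cast
  rfl

lemma moment_eq (Q : PMF ℕ) (i : ℕ) : moment Q i = (emean Q fun k => k ^ i).toReal := by
  rw [moment, integral_eq_lintegral_of_nonneg_ae (Eventually.of_forall fun k => by positivity)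
    (measurable_of_countable _).aestronglyMeasurable, lintegral_pow]

lemma integrable_pow_iff (Q : PMF ℕ) (i : ℕ) :
    Integrable (fun k : ℕ => (k : ℝ) ^ i) Q.toMeasure ↔ (emean Q fun k => k ^ i) ≠ ⊤ := by
  rw [← lintegral_pow, ← lt_top_iff_ne_top, ← hasFiniteIntegral_iff_ofReal
    (Eventually.of_forall fun k => by positivity)]
  exact ⟨fun h => h.2, fun h => ⟨(measurable_of_countable _).aestronglyMeasurable, h⟩⟩

/-- The factorial moment `E (Z)_i` of a random variable with law `Q`. -/
def factMoment (Q : PMF ℕ) (i : ℕ) : ℝ := (emean Q fun k => k.descFactorial i).toReal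

/-- The order i = 0 is excluded because (0)_0 = 1 exceeds 0⁴. -/
lemma descFactorial_le_pow_four {i : ℕ} (hi : i ∈ Finset.Icc 1 4) (k : ℕ) :
    k.descFactorial i ≤ k ^ 4 := by
  rw [Finset.mem_Icc] at hi
  rcases Nat.eq_zero_or_pos k with rfl | hk
  · rw [Nat.descFactorial_eq_zero_iff_lt.2 (by omega)]
    exact Nat.zero_le _
  · exact (Nat.descFactorial_le_pow _ _).trans (Nat.pow_le_pow_right hk hi.2)

lemma emean_descFactorial_ne_top {Q : PMF ℕ} (h : (emean Q fun k => k ^ 4) ≠ ⊤) {i : ℕ}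
    (hi : i ∈ Finset.Icc 1 4) : (emean Q fun k => k.descFactorial i) ≠ ⊤ :=
  ne_top_of_le_ne_top h (emean_mono Q (descFactorial_le_pow_four hi))

lemma tendsto_sizeFactMoment {m : ℕ → ℕ} {P : ∀ n, PMF (Fin (m n + 1))} {Q : PMF ℕ}
    (h : TendstoInDistribution (fun (n : ℕ) (k : Fin (m n + 1)) => (k : ℕ)) atTop
      (id : ℕ → ℕ) (fun n => (P n).toMeasure) Q.toMeasure)
    (h_four : (emean Q fun k => k ^ 4) ≠ ⊤)
    (h_lim : Tendsto (fun n => sizeMoment (P n) 4) atTop (𝓝 (moment Q 4)))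
    {i : ℕ} (hi : i ∈ Finset.Icc 1 4) :
    Tendsto (fun n => sizeFactMoment (P n) i) atTop (𝓝 (factMoment Q i)) := by
  have hQ := hasSum_emean h_four
  push_cast at hQ
  have key := tendsto_tsum_of_dominated_moment (a := fun n => sizeLaw (P n))
    (b := fun k => (Q k).toReal) (w := fun k => (k : ℝ) ^ 4)
    (f := fun k => (k.descFactorial i : ℝ)) (fun n k => sizeLaw_nonneg _ _) (fun k => by simp)
    (fun k => by
      rw [Nat.abs_cast]
      exact_mod_cast descFactorial_le_pow_four hi k)
    (tendsto_sizeLaw h) (fun n => (hasSum_sizeLaw (P n) _).summable) hQ.summable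
    (by
      rw [hQ.tsum_eq, ← moment_eq]
      exact h_lim.congr fun n => (hasSum_sizeLaw (P n) fun k => (k : ℝ) ^ 4).tsum_eq.symm)
  rw [factMoment, emean_toReal]
  exact key.congr fun n => (hasSum_sizeLaw (P n) fun k => (k.descFactorial i : ℝ)).tsum_eq

/-! ### The variance of the size-biased set size -/

/-- Truncated subtraction does no harm: for k < i the factor (k)_i vanishes. -/
lemma cast_descFactorial_succ (k i : ℕ) :
    ((k.descFactorial (i + 1) : ℕ) : ℝ) = ((k : ℝ) - i) * (k.descFactorial i : ℝ) := by
  rw [Nat.descFactorial_succ]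
  rcases le_or_gt i k with h | h
  · rw [Nat.cast_mul, Nat.cast_sub h]
  · rw [Nat.descFactorial_eq_zero_iff_lt.2 h]
    simp

/-- Since (k)_2 (k - 2) = (k)_3 and (k)_2 (k - 2)² = (k)_4 + (k)_3, expanding the square gives V/y₂.
When the weights a_k (k)_2 are nonnegative, y₃/y₂ is the mean of k - 2 under them, and V is
nonnegative. -/
lemma hasSum_sizeBiased_variance {a : ℕ → ℝ} {y₂ y₃ y₄ : ℝ}
    (h₂ : HasSum (fun k => a k * (k.descFactorial 2 : ℝ)) y₂)
    (h₃ : HasSum (fun k => a k * (k.descFactorial 3 : ℝ)) y₃)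
    (h₄ : HasSum (fun k => a k * (k.descFactorial 4 : ℝ)) y₄) (hy : y₂ ≠ 0) :
    HasSum (fun k => a k * (k.descFactorial 2 : ℝ) * ((k : ℝ) - 2 - y₃ / y₂) ^ 2)
      ((y₂ * y₄ + y₂ * y₃ - y₃ ^ 2) / y₂) := by
  have h := ((h₄.add h₃).sub (h₃.mul_left (2 * (y₃ / y₂)))).add (h₂.mul_left ((y₃ / y₂) ^ 2))
  have hsum : (y₂ * y₄ + y₂ * y₃ - y₃ ^ 2) / y₂
      = y₄ + y₃ - 2 * (y₃ / y₂) * y₃ + (y₃ / y₂) ^ 2 * y₂ := by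
    field_simp
    ring
  rw [hsum]
  refine h.congr_fun fun k => ?_
  rw [cast_descFactorial_succ k 3, cast_descFactorial_succ k 2]
  push_cast
  ring

lemma sizeBiased_variance_nonneg {m : ℕ} (P : PMF (Fin (m + 1))) (hy : 0 < sizeFactMoment P 2) :
    0 ≤ sizeFactMoment P 2 * sizeFactMoment P 4 + sizeFactMoment P 2 * sizeFactMoment P 3
      - sizeFactMoment P 3 ^ 2 := by
  have h := hasSum_sizeBiased_variance (hasSum_sizeLaw P fun k => (k.descFactorial 2 : ℝ))
    (hasSum_sizeLaw P fun k => (k.descFactorial 3 : ℝ))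
    (hasSum_sizeLaw P fun k => (k.descFactorial 4 : ℝ)) hy.ne'
  have h' := h.nonneg fun k => mul_nonneg (mul_nonneg (sizeLaw_nonneg P k) (by positivity))
    (sq_nonneg _)
  exact (mul_nonneg h' hy.le).trans_eq (div_mul_cancel₀ _ hy.ne')

lemma hasSum_factMoment {Q : PMF ℕ} (h : (emean Q fun k => k ^ 4) ≠ ⊤) {i : ℕ}
    (hi : i ∈ Finset.Icc 1 4) :
    HasSum (fun k => (Q k).toReal * (k.descFactorial i : ℝ)) (factMoment Q i) :=
  hasSum_emean (emean_descFactorial_ne_top h hi)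

lemma factMoment_two_pos {Q : PMF ℕ} (h : (emean Q fun k => k ^ 4) ≠ ⊤)
    (h_two : 0 < Q.toMeasure {k | 2 ≤ k}) : 0 < factMoment Q 2 := by
  obtain ⟨j, hj, hQj⟩ : ∃ j, 2 ≤ j ∧ Q j ≠ 0 := by
    by_contra! hcon
    refine h_two.ne' ?_
    rw [Q.toMeasure_apply_eq_zero_iff (MeasurableSet.of_discrete), Set.disjoint_left]
    intro k hk hk'
    exact (Q.mem_support_iff k).1 hk (hcon k hk')
  have h1 : 0 < (Q j).toReal := ENNReal.toReal_pos hQj (Q.apply_ne_top j)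
  have h2 : (0 : ℝ) < j.descFactorial 2 := by exact_mod_cast Nat.descFactorial_pos.2 hj
  exact (mul_pos h1 h2).trans_le
    (le_hasSum (hasSum_factMoment h (by simp)) j fun k _ => by positivity)

lemma sizeBiased_variance_limit_nonneg {Q : PMF ℕ} (h : (emean Q fun k => k ^ 4) ≠ ⊤)
    (hz : 0 < factMoment Q 2) :
    0 ≤ factMoment Q 2 * factMoment Q 4 + factMoment Q 2 * factMoment Q 3
      - factMoment Q 3 ^ 2 := by
  have h' := (hasSum_sizeBiased_variance (hasSum_factMoment h (by simp))
    (hasSum_factMoment h (by simp)) (hasSum_factMoment h (by simp)) hz.ne').nonneg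
    fun k => by positivity
  exact (mul_nonneg h' hz.le).trans_eq (div_mul_cancel₀ _ hz.ne')

/-- Two distinct atoms cannot both sit at the mean, so at least one square in the sum is positive.
-/
lemma sizeBiased_variance_limit_pos {Q : PMF ℕ} (h : (emean Q fun k => k ^ 4) ≠ ⊤)
    (hz : 0 < factMoment Q 2)
    (hij : ∃ i j : ℕ, 2 ≤ i ∧ 2 ≤ j ∧ i ≠ j ∧ Q i ≠ 0 ∧ Q j ≠ 0) :
    0 < factMoment Q 2 * factMoment Q 4 + factMoment Q 2 * factMoment Q 3
      - factMoment Q 3 ^ 2 := by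
  have h1 := hasSum_sizeBiased_variance (hasSum_factMoment h (by simp))
    (hasSum_factMoment h (by simp)) (hasSum_factMoment h (by simp)) hz.ne'
  obtain ⟨t, ht2, htQ, htne⟩ : ∃ t : ℕ, 2 ≤ t ∧ Q t ≠ 0 ∧
      (t : ℝ) - 2 - factMoment Q 3 / factMoment Q 2 ≠ 0 := by
    obtain ⟨i, j, hi, hj, hne, hQi, hQj⟩ := hij
    by_cases hi' : (i : ℝ) - 2 - factMoment Q 3 / factMoment Q 2 = 0
    · refine ⟨j, hj, hQj, fun hj' => hne ?_⟩
      have : (i : ℝ) = j := by linarith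
      exact_mod_cast this
    · exact ⟨i, hi, hQi, hi'⟩
  have h2 : 0 < (Q t).toReal := ENNReal.toReal_pos htQ (Q.apply_ne_top t)
  have h3 : (0 : ℝ) < t.descFactorial 2 := by exact_mod_cast Nat.descFactorial_pos.2 ht2
  have h4 := (by positivity : 0 < (Q t).toReal * (t.descFactorial 2 : ℝ) *
    ((t : ℝ) - 2 - factMoment Q 3 / factMoment Q 2) ^ 2).trans_le
    (le_hasSum h1 t fun k _ => by positivity)
  exact (div_pos_iff_of_pos_right hz).1 h4

/-! ### Moments of the compound Poisson law -/

lemma emean_add (Q : PMF ℕ) (f g : ℕ → ℕ) :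
    emean Q (fun k => f k + g k) = emean Q f + emean Q g := by
  simp only [emean, Nat.cast_add, mul_add]
  exact ENNReal.tsum_add

lemma emean_const_mul (Q : PMF ℕ) (c : ℕ) (f : ℕ → ℕ) :
    emean Q (fun k => c * f k) = c * emean Q f := by
  simp only [emean, ← ENNReal.tsum_mul_left]
  refine tsum_congr fun k => ?_
  push_cast
  ring

lemma emean_const (Q : PMF ℕ) (c : ℕ) : emean Q (fun _ => c) = c := by
  simp only [emean, ENNReal.tsum_mul_right, Q.tsum_coe, one_mul]

lemma emean_pure (a : ℕ) (f : ℕ → ℕ) : emean (PMF.pure a) f = f a := by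
  rw [emean, tsum_eq_single a fun k hk => by simp [PMF.pure_apply, hk]]
  simp

lemma emean_bind (p : PMF ℕ) (κ : ℕ → PMF ℕ) (f : ℕ → ℕ) :
    emean (p.bind κ) f = ∑' a, p a * emean (κ a) f := by
  simp only [emean, PMF.bind_apply, ← ENNReal.tsum_mul_right, ← ENNReal.tsum_mul_left]
  rw [ENNReal.tsum_comm]
  simp only [mul_assoc]

lemma emean_map (p : PMF ℕ) (g f : ℕ → ℕ) : emean (p.map g) f = emean p fun k => f (g k) := by
  rw [← PMF.bind_pure_comp, emean_bind]
  simp only [Function.comp_apply, emean_pure]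
  rfl

/-- The mean of a sum of `k` independent variables. -/
lemma emean_iidSumLaw_one (R : PMF ℕ) (k : ℕ) :
    emean (iidSumLaw R k) (fun s => s) = k * emean R fun z => z := by
  induction k with
  | zero => simp [iidSumLaw, emean_pure]
  | succ k ih =>
    rw [iidSumLaw, emean_bind]
    have h : ∀ s : ℕ, emean (R.map fun z => s + z) (fun s => s) = s + emean R fun z => z := by
      intro s
      rw [emean_map, emean_add, emean_const]
    simp only [h, mul_add, ENNReal.tsum_add, ENNReal.tsum_mul_right, PMF.tsum_coe]
    rw [emean] at ih
    rw [ih]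
    push_cast
    ring

/-- The square of the sum has k diagonal and (k)_2 off-diagonal products. Falling factorials are
kept because their Poisson means are pure powers; values in [0, ∞] avoid finiteness conditions. -/
lemma emean_iidSumLaw_two (R : PMF ℕ) (k : ℕ) :
    emean (iidSumLaw R k) (fun s => s ^ 2)
      = k * emean R (fun z => z ^ 2) + k.descFactorial 2 * (emean R fun z => z) ^ 2 := by
  induction k with
  | zero => simp [iidSumLaw, emean_pure]
  | succ k ih =>
    rw [iidSumLaw, emean_bind]
    have h : ∀ s : ℕ, emean (R.map fun z => s + z) (fun s => s ^ 2)
        = ((s ^ 2 : ℕ) : ENNReal) + s * (2 * emean R fun z => z) + emean R fun z => z ^ 2 := by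
      intro s
      rw [emean_map]
      have : (fun z => (s + z) ^ 2) = fun z => (s ^ 2 + 2 * s * z) + z ^ 2 := by funext z; ring
      rw [this, emean_add, emean_add, emean_const, emean_const_mul]
      push_cast
      ring
    simp only [h, mul_add, ENNReal.tsum_add, ENNReal.tsum_mul_right, PMF.tsum_coe, ← mul_assoc]
    have ih1 := emean_iidSumLaw_one R k
    rw [emean] at ih ih1
    rw [ih, ih1, Nat.succ_descFactorial_succ, Nat.descFactorial_succ k 1]
    have h2 : (((k + 1) * k.descFactorial 1 : ℕ) : ENNReal)
        = (((k - 1) * k.descFactorial 1 : ℕ) : ENNReal) + 2 * k := by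
      rw [Nat.descFactorial_one]
      rcases k with _ | k
      · simp
      · push_cast
        ring
    rw [h2]
    push_cast
    ring

lemma emean_iidSumLaw_three (R : PMF ℕ) (k : ℕ) :
    emean (iidSumLaw R k) (fun s => s ^ 3)
      = k * emean R (fun z => z ^ 3)
        + 3 * (k.descFactorial 2 * ((emean R fun z => z) * emean R fun z => z ^ 2))
        + k.descFactorial 3 * (emean R fun z => z) ^ 3 := by
  induction k with
  | zero => simp [iidSumLaw, emean_pure]
  | succ k ih =>
    rw [iidSumLaw, emean_bind]
    have h : ∀ s : ℕ, emean (R.map fun z => s + z) (fun s => s ^ 3)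
        = ((s ^ 3 : ℕ) : ENNReal) + ((s ^ 2 : ℕ) : ENNReal) * (3 * emean R fun z => z)
          + s * (3 * emean R fun z => z ^ 2) + emean R fun z => z ^ 3 := by
      intro s
      rw [emean_map]
      have : (fun z => (s + z) ^ 3)
          = fun z => ((s ^ 3 + 3 * s ^ 2 * z) + 3 * s * z ^ 2) + z ^ 3 := by funext z; ring
      rw [this, emean_add, emean_add, emean_add, emean_const, emean_const_mul, emean_const_mul]
      push_cast
      ring
    simp only [h, mul_add, ENNReal.tsum_add, ENNReal.tsum_mul_right, PMF.tsum_coe, ← mul_assoc]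
    have ih1 := emean_iidSumLaw_one R k
    have ih2 := emean_iidSumLaw_two R k
    rw [emean] at ih ih1 ih2
    rw [ih, ih1, ih2]
    have h2 : (((k + 1).descFactorial 2 : ℕ) : ENNReal) = k.descFactorial 2 + 2 * k := by
      rcases k with _ | k
      · simp
      · simp only [Nat.descFactorial_succ, Nat.descFactorial_zero]
        push_cast
        ring
    have h3 : (((k + 1).descFactorial 3 : ℕ) : ENNReal)
        = k.descFactorial 3 + 3 * k.descFactorial 2 := by
      rcases k with _ | _ | k
      · simp
      · simp [Nat.descFactorial_succ]
      · simp only [Nat.descFactorial_succ, Nat.descFactorial_zero, Nat.sub_zero,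
          show k + 1 + 1 + 1 - 2 = k + 1 by omega, show k + 1 + 1 + 1 - 1 = k + 2 by omega,
          show k + 1 + 1 - 2 = k by omega, show k + 1 + 1 - 1 = k + 1 by omega]
        push_cast
        ring
    rw [h2, h3]
    push_cast
    ring

/-- The factorial moments of the Poisson law. -/
lemma tsum_poisson_descFactorial (r : NNReal) (i : ℕ) :
    ∑' k : ℕ, (poissonMeasure r).toPMF k * (k.descFactorial i : ENNReal) = (r : ENNReal) ^ i := by
  induction i with
  | zero => simp
  | succ i ih =>
    -- The term k = 0 vanishes; after the shift, (k + 1) P(k + 1) = r P(k) lowers the factorial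
    -- order by one.
    rw [tsum_eq_zero_add' ENNReal.summable, pow_succ, ← ih, ← ENNReal.tsum_mul_right]
    simp only [Nat.zero_descFactorial_succ, Nat.cast_zero, mul_zero, zero_add]
    refine tsum_congr fun k => ?_
    have h : (poissonMeasure r).toPMF (k + 1) * ((k + 1 : ℕ) : ENNReal)
        = (poissonMeasure r).toPMF k * r := by
      rw [Measure.toPMF_apply, Measure.toPMF_apply, poissonMeasure_singleton,
        poissonMeasure_singleton, ← ENNReal.ofReal_natCast, ← ENNReal.ofReal_coe_nnreal,
        ← ENNReal.ofReal_mul (by positivity), ← ENNReal.ofReal_mul (by positivity)]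
      congr 1
      rw [Nat.factorial_succ]
      push_cast
      field_simp
      ring
    rw [Nat.succ_descFactorial_succ, Nat.cast_mul, ← mul_assoc, h]
    ring

section
variable (Q : PMF ℕ) (β : ℝ)

/-- With r the Poisson mean, the numbers c_i = r E Z̃^i are the cumulants of the compound Poisson
law; its first three moments are c₁, c₂ + c₁² and c₃ + 3c₁c₂ + c₁³. -/
lemma emean_degreeLaw_one :
    emean (degreeLaw Q β) (fun k => k)
      = (β⁻¹ * moment Q 1).toNNReal * emean (tildeLaw Q) fun z => z := by
  have h1 := tsum_poisson_descFactorial (β⁻¹ * moment Q 1).toNNReal 1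
  simp only [Nat.descFactorial_one, pow_one] at h1
  rw [degreeLaw, emean_bind]
  simp only [emean_iidSumLaw_one, ← mul_assoc, ENNReal.tsum_mul_right]
  rw [h1]

lemma emean_degreeLaw_two :
    emean (degreeLaw Q β) (fun k => k ^ 2)
      = (β⁻¹ * moment Q 1).toNNReal * emean (tildeLaw Q) (fun z => z ^ 2)
        + ((β⁻¹ * moment Q 1).toNNReal * emean (tildeLaw Q) fun z => z) ^ 2 := by
  have h1 := tsum_poisson_descFactorial (β⁻¹ * moment Q 1).toNNReal 1
  have h2 := tsum_poisson_descFactorial (β⁻¹ * moment Q 1).toNNReal 2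
  simp only [Nat.descFactorial_one, pow_one] at h1
  rw [degreeLaw, emean_bind]
  simp only [emean_iidSumLaw_two, mul_add, ENNReal.tsum_add, ← mul_assoc, ENNReal.tsum_mul_right]
  rw [h1, h2]
  ring

lemma emean_degreeLaw_three :
    emean (degreeLaw Q β) (fun k => k ^ 3)
      = (β⁻¹ * moment Q 1).toNNReal * emean (tildeLaw Q) (fun z => z ^ 3)
        + 3 * (((β⁻¹ * moment Q 1).toNNReal * emean (tildeLaw Q) fun z => z)
          * ((β⁻¹ * moment Q 1).toNNReal * emean (tildeLaw Q) fun z => z ^ 2))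
        + ((β⁻¹ * moment Q 1).toNNReal * emean (tildeLaw Q) fun z => z) ^ 3 := by
  have h1 := tsum_poisson_descFactorial (β⁻¹ * moment Q 1).toNNReal 1
  have h2 := tsum_poisson_descFactorial (β⁻¹ * moment Q 1).toNNReal 2
  have h3 := tsum_poisson_descFactorial (β⁻¹ * moment Q 1).toNNReal 3
  simp only [Nat.descFactorial_one, pow_one] at h1
  rw [degreeLaw, emean_bind]
  have h4 : ∀ k : ℕ, (poissonMeasure (β⁻¹ * moment Q 1).toNNReal).toPMF k
      * emean (iidSumLaw (tildeLaw Q) k) (fun k => k ^ 3)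
      = (poissonMeasure (β⁻¹ * moment Q 1).toNNReal).toPMF k * k
          * emean (tildeLaw Q) (fun z => z ^ 3)
        + (poissonMeasure (β⁻¹ * moment Q 1).toNNReal).toPMF k * k.descFactorial 2
          * (3 * ((emean (tildeLaw Q) fun z => z) * emean (tildeLaw Q) fun z => z ^ 2))
        + (poissonMeasure (β⁻¹ * moment Q 1).toNNReal).toPMF k * k.descFactorial 3
          * (emean (tildeLaw Q) fun z => z) ^ 3 := by
    intro k
    rw [emean_iidSumLaw_three]
    ring
  simp only [h4, ENNReal.tsum_add, ENNReal.tsum_mul_right]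
  rw [h1, h2, h3]
  ring

end

lemma tsum_succ_mul (Q : PMF ℕ) (f : ℕ → ℕ) :
    ∑' j : ℕ, ((j + 1 : ℕ) : ENNReal) * Q (j + 1) * (f j : ENNReal)
      = emean Q fun k => k * f (k - 1) := by
  rw [emean, tsum_eq_zero_add' (f := fun k => Q k * ((k * f (k - 1) : ℕ) : ENNReal))
    ENNReal.summable]
  simp only [zero_mul, Nat.cast_zero, mul_zero, zero_add, Nat.add_sub_cancel]
  refine tsum_congr fun j => ?_
  push_cast
  ring

/-- Size-biasing with a shift by one; the factor k suppresses the truncated value of k - 1 at k = 0.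
-/
lemma emean_tildeLaw {Q : PMF ℕ} (h0 : (emean Q fun k => k) ≠ 0) (h1 : (emean Q fun k => k) ≠ ⊤)
    (f : ℕ → ℕ) :
    emean (tildeLaw Q) f = (emean Q fun k => k * f (k - 1)) / emean Q fun k => k := by
  have hsum : ∑' j : ℕ, ((j + 1 : ℕ) : ENNReal) * Q (j + 1) = emean Q fun k => k := by
    simpa using tsum_succ_mul Q fun _ => 1
  rw [tildeLaw, dif_pos (by rw [hsum]; exact ⟨h0, h1⟩), emean]
  simp only [PMF.normalize_apply]
  rw [hsum, ← tsum_succ_mul, ENNReal.div_eq_inv_mul, ← ENNReal.tsum_mul_left]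
  refine tsum_congr fun j => ?_
  ring

/-- The moments of the compound Poisson law in terms of the factorial moments of `Q`. -/
lemma degreeLaw_moments {Q : PMF ℕ} (h : (emean Q fun k => k ^ 4) ≠ ⊤) (hz : 0 < factMoment Q 2)
    {β : ℝ} (hβ : 0 < β) :
    Integrable (fun k : ℕ => (k : ℝ) ^ 3) (degreeLaw Q β).toMeasure ∧
      moment (degreeLaw Q β) 1 = β⁻¹ * factMoment Q 2 ∧
      moment (degreeLaw Q β) 2
        = β⁻¹ * (factMoment Q 3 + factMoment Q 2) + (β⁻¹ * factMoment Q 2) ^ 2 ∧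
      moment (degreeLaw Q β) 3
        = β⁻¹ * (factMoment Q 4 + 3 * factMoment Q 3 + factMoment Q 2)
          + 3 * ((β⁻¹ * factMoment Q 2) * (β⁻¹ * (factMoment Q 3 + factMoment Q 2)))
          + (β⁻¹ * factMoment Q 2) ^ 3 := by
  have hfin : ∀ i ∈ Finset.Icc 1 4, (emean Q fun k => k.descFactorial i) ≠ ⊤ :=
    fun i hi => emean_descFactorial_ne_top h hi
  have hE : (emean Q fun k => k) ≠ ⊤ := by simpa using hfin 1 (by simp)
  have hE0 : (emean Q fun k => k) ≠ 0 := by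
    intro h0
    have h1 : (emean Q fun k => k.descFactorial 2) = 0 := by
      simp only [emean, ENNReal.tsum_eq_zero, mul_eq_zero] at h0 ⊢
      intro k
      refine (h0 k).imp_right fun h0 => ?_
      have : k = 0 := by exact_mod_cast h0
      simp [this]
    rw [factMoment, h1] at hz
    simp at hz
  have hm1 : moment Q 1 = (emean Q fun k => k).toReal := by simp [moment_eq]
  set E := emean Q fun k => k
  have hr : (((β⁻¹ * moment Q 1).toNNReal : NNReal) : ENNReal) = ENNReal.ofReal β⁻¹ * E := by
    rw [hm1, ← ENNReal.ofReal.eq_1, ENNReal.ofReal_mul (by positivity), ENNReal.ofReal_toReal hE]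
  -- The factor E Z in the Poisson mean cancels the normalisation of the size-biased law, so the
  -- cumulants are β⁻¹ E Z(Z - 1)^i.
  have hcancel : ∀ x : ENNReal, ENNReal.ofReal β⁻¹ * E * (x / E) = ENNReal.ofReal β⁻¹ * x := by
    intro x
    rw [mul_assoc, ENNReal.mul_div_cancel hE0 hE]
  have hf1 : (emean Q fun k => k * (k - 1)) = emean Q fun k => k.descFactorial 2 := by
    congr 1
    funext k
    simp [Nat.descFactorial_succ, mul_comm]
  have hf2 : (emean Q fun k => k * (k - 1) ^ 2)
      = (emean Q fun k => k.descFactorial 3) + emean Q fun k => k.descFactorial 2 := by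
    rw [← emean_add]
    congr 1
    funext k
    rcases k with _ | _ | k
    · simp
    · simp [Nat.descFactorial_succ]
    · simp only [Nat.descFactorial_succ, Nat.descFactorial_zero, Nat.sub_zero,
        show k + 1 + 1 - 2 = k by omega, show k + 1 + 1 - 1 = k + 1 by omega]
      ring
  have hf3 : (emean Q fun k => k * (k - 1) ^ 3)
      = (emean Q fun k => k.descFactorial 4) + (3 : ℕ) * (emean Q fun k => k.descFactorial 3)
        + emean Q fun k => k.descFactorial 2 := by
    rw [← emean_const_mul, ← emean_add, ← emean_add]
    congr 1
    funext k
    rcases k with _ | _ | _ | k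
    · simp
    · simp [Nat.descFactorial_succ]
    · simp [Nat.descFactorial_succ]
    · simp only [Nat.descFactorial_succ, Nat.descFactorial_zero, Nat.sub_zero,
        show k + 1 + 1 + 1 - 3 = k by omega, show k + 1 + 1 + 1 - 2 = k + 1 by omega,
        show k + 1 + 1 + 1 - 1 = k + 2 by omega]
      ring
  have hb : ENNReal.ofReal β⁻¹ ≠ ⊤ := ENNReal.ofReal_ne_top
  have ht2 := hfin 2 (by simp)
  have ht3 := hfin 3 (by simp)
  have ht4 := hfin 4 (by simp)
  have hβr : (ENNReal.ofReal β⁻¹).toReal = β⁻¹ := ENNReal.toReal_ofReal (by positivity)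
  have e1 := emean_degreeLaw_one Q β
  have e2 := emean_degreeLaw_two Q β
  have e3 := emean_degreeLaw_three Q β
  rw [hr, emean_tildeLaw hE0 hE, hcancel, hf1] at e1
  rw [hr, emean_tildeLaw hE0 hE, emean_tildeLaw hE0 hE, hcancel, hcancel, hf1, hf2] at e2
  rw [hr, emean_tildeLaw hE0 hE, emean_tildeLaw hE0 hE, emean_tildeLaw hE0 hE, hcancel, hcancel,
    hcancel, hf1, hf2, hf3] at e3
  simp only [factMoment]
  generalize (emean Q fun k => k.descFactorial 2) = z₂ at *
  generalize (emean Q fun k => k.descFactorial 3) = z₃ at *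
  generalize (emean Q fun k => k.descFactorial 4) = z₄ at *
  generalize ENNReal.ofReal β⁻¹ = B at *
  lift z₂ to NNReal using ht2
  lift z₃ to NNReal using ht3
  lift z₄ to NNReal using ht4
  lift B to NNReal using hb
  simp only [ENNReal.coe_toReal] at hβr ⊢
  rw [integrable_pow_iff, moment_eq, moment_eq, moment_eq, e2, e3]
  simp only [pow_one, e1, ← hβr]
  refine ⟨?_, ?_, ?_, ?_⟩
  · norm_cast
    exact ENNReal.coe_ne_top
  · norm_cast
  · norm_cast
  · norm_cast

/-! ### The assortativity coefficient in the three regimes -/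

lemma tendsto_assortativity_sub {m : ℕ → ℕ} {P : ∀ n, PMF (Fin (m n + 1))} {Q : PMF ℕ}
    (hm : Tendsto m atTop atTop)
    (hy : ∀ i ∈ Finset.Icc 1 4,
      Tendsto (fun n => sizeFactMoment (P n) i) atTop (𝓝 (factMoment Q i)))
    (hz : 0 < factMoment Q 2)
    (hu : Tendsto (fun n : ℕ => (n : ℝ) / (m n : ℝ) ^ 2) atTop (𝓝 0)) :
    Tendsto (fun n : ℕ => assortativity n (P n) - assortFormula (P n) ((m n : ℝ) / n))
      atTop (𝓝 0) := by
  have hpos : ∀ᶠ n in atTop, factMoment Q 2 / 2 < sizeFactMoment (P n) 2 :=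
    (hy 2 (by simp)).eventually_const_lt (by linarith)
  refine tendsto_assortativity_sub_assortFormula hm (fun i hi => ?_) (half_pos hz)
    (hpos.mono fun n hn => hn.le)
    (hpos.mono fun n hn => sizeBiased_variance_nonneg _ ((half_pos hz).trans hn))
    (eventually_gt_atTop 0) hu ?_
  · rw [Finset.mem_Icc] at hi
    exact (hy i (Finset.mem_Icc.2 ⟨by omega, hi.2⟩)).isBigO_one ℝ
  -- The relative error (1/m + n/m²)/(n/m) equals 1/n + 1/m, whatever the size of β_n.
  · have h1 : Tendsto (fun n : ℕ => (n : ℝ)⁻¹ + ((m n : ℕ) : ℝ)⁻¹) atTop (𝓝 (0 + 0)) :=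
      tendsto_inv_atTop_nhds_zero_nat.add
        (tendsto_inv_atTop_zero.comp (tendsto_natCast_atTop_atTop.comp hm))
    rw [add_zero] at h1
    refine h1.congr' ?_
    filter_upwards [eventually_gt_atTop 0, hm.eventually_gt_atTop 0] with n hn hmn
    have hn' : (n : ℝ) ≠ 0 := by exact_mod_cast hn.ne'
    have hm' : (m n : ℝ) ≠ 0 := by exact_mod_cast hmn.ne'
    field_simp

/-- n/m² is β_n⁻¹/m, and β_n⁻¹ stays bounded in regimes (a) and (b). -/
lemma tendsto_div_sq_of_tendsto_inv {m : ℕ → ℕ} (hm : Tendsto m atTop atTop) {b : ℝ}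
    (h : Tendsto (fun n : ℕ => ((m n : ℝ) / n)⁻¹) atTop (𝓝 b)) :
    Tendsto (fun n : ℕ => (n : ℝ) / (m n : ℝ) ^ 2) atTop (𝓝 0) := by
  have h1 := h.mul (tendsto_inv_atTop_zero.comp (tendsto_natCast_atTop_atTop (R := ℝ).comp hm))
  rw [mul_zero] at h1
  refine h1.congr fun n => ?_
  simp only [Function.comp_apply, inv_div]
  ring

/-- The square of n/m² is (n β_n³)⁻¹ m⁻¹. This is where regime (c) needs n β_n³ → ∞. -/
lemma tendsto_div_sq_of_tendsto_cube {m : ℕ → ℕ} (hm : Tendsto m atTop atTop)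
    (h : Tendsto (fun n : ℕ => (n : ℝ) * ((m n : ℝ) / n) ^ 3) atTop atTop) :
    Tendsto (fun n : ℕ => (n : ℝ) / (m n : ℝ) ^ 2) atTop (𝓝 0) := by
  have h1 := (tendsto_inv_atTop_zero.comp h).mul
    (tendsto_inv_atTop_zero.comp (tendsto_natCast_atTop_atTop (R := ℝ).comp hm))
  rw [mul_zero] at h1
  have h2 := h1.sqrt
  rw [Real.sqrt_zero] at h2
  refine h2.congr' ?_
  filter_upwards [eventually_gt_atTop 0, hm.eventually_gt_atTop 0] with n hn hmn
  have hn' : (0 : ℝ) < n := by exact_mod_cast hn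
  have hm' : (0 : ℝ) < m n := by exact_mod_cast hmn
  rw [← Real.sqrt_sq (show (0 : ℝ) ≤ n / (m n : ℝ) ^ 2 by positivity)]
  congr 1
  simp only [Function.comp_apply]
  field_simp

lemma tendsto_assortFormula {m : ℕ → ℕ} {P : ∀ n, PMF (Fin (m n + 1))} {Q : PMF ℕ}
    (hy : ∀ i ∈ Finset.Icc 1 4,
      Tendsto (fun n => sizeFactMoment (P n) i) atTop (𝓝 (factMoment Q i)))
    {β : ℕ → ℝ} {b : ℝ} (hb : Tendsto (fun n => (β n)⁻¹) atTop (𝓝 b))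
    (hne : factMoment Q 2 * factMoment Q 4 + factMoment Q 2 * factMoment Q 3 - factMoment Q 3 ^ 2
      + b * factMoment Q 2 ^ 2 * (factMoment Q 2 + factMoment Q 3) ≠ 0) :
    Tendsto (fun n => assortFormula (P n) (β n)) atTop
      (𝓝 ((factMoment Q 2 * factMoment Q 4 + factMoment Q 2 * factMoment Q 3 - factMoment Q 3 ^ 2) /
        (factMoment Q 2 * factMoment Q 4 + factMoment Q 2 * factMoment Q 3 - factMoment Q 3 ^ 2
          + b * factMoment Q 2 ^ 2 * (factMoment Q 2 + factMoment Q 3)))) := by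
  have h2 := hy 2 (by simp)
  have h3 := hy 3 (by simp)
  have h4 := hy 4 (by simp)
  have hV := ((h2.mul h4).add (h2.mul h3)).sub (h3.pow 2)
  exact hV.div (hV.add ((hb.mul (h2.pow 2)).mul (h2.add h3))) hne

lemma tendsto_assortFormula_zero {m : ℕ → ℕ} {P : ∀ n, PMF (Fin (m n + 1))} {Q : PMF ℕ}
    (hy : ∀ i ∈ Finset.Icc 1 4,
      Tendsto (fun n => sizeFactMoment (P n) i) atTop (𝓝 (factMoment Q i)))
    (hz : 0 < factMoment Q 2)
    {β : ℕ → ℝ} (hb : Tendsto (fun n => (β n)⁻¹) atTop atTop) :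
    Tendsto (fun n => assortFormula (P n) (β n)) atTop (𝓝 0) := by
  have h2 := hy 2 (by simp)
  have h3 := hy 3 (by simp)
  have h4 := hy 4 (by simp)
  have hV := ((h2.mul h4).add (h2.mul h3)).sub (h3.pow 2)
  have hz3 : 0 ≤ factMoment Q 3 := ENNReal.toReal_nonneg
  exact hV.div_atTop (hV.add_atTop ((hb.atTop_mul_pos (by positivity) (h2.pow 2)).atTop_mul_pos
    (by positivity) (h2.add h3)))

end PassiveRIG

end

/-! ### The three regimes of β_n. -/

theorem theorem3
    -- `m n` is the number of vertices, `n` the number of random sets, `P n` the law of their sizes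
    (m : ℕ → ℕ) (P : ∀ n, PMF (Fin (m n + 1)))
    -- the law of the limit `Z` of the set sizes
    (Q : PMF ℕ)
    (hm : Tendsto m atTop atTop)
    -- (iii): `X₁` converges in distribution to `Z`
    (h_iii : TendstoInDistribution (fun (n : ℕ) (k : Fin (m n + 1)) => (k : ℕ)) atTop
      (id : ℕ → ℕ) (fun n => (P n).toMeasure) Q.toMeasure)
    -- (v): `P(Z ≥ 2) > 0`, `E Z⁴ < ∞` and `E X₁⁴ → E Z⁴`
    (h_two : 0 < Q.toMeasure {k | 2 ≤ k})
    (h_four : Integrable (fun k : ℕ => (k : ℝ) ^ 4) Q.toMeasure)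
    (h_lim : Tendsto (fun n => PassiveRIG.sizeMoment (P n) 4) atTop
      (𝓝 (PassiveRIG.moment Q 4))) :
    -- `β_n → β ∈ (0, ∞)`
    (∀ β : ℝ, 0 < β → Tendsto (fun n : ℕ => (m n : ℝ) / n) atTop (𝓝 β) →
      Tendsto (fun n : ℕ => PassiveRIG.assortativity n (P n) -
        PassiveRIG.assortFormula (P n) ((m n : ℝ) / n)) atTop (𝓝 0) ∧
      Integrable (fun k : ℕ => (k : ℝ) ^ 3) (PassiveRIG.degreeLaw Q β).toMeasure ∧
      Tendsto (fun n : ℕ => PassiveRIG.assortativity n (P n)) atTop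
        (𝓝 (1 -
          (PassiveRIG.moment (PassiveRIG.degreeLaw Q β) 2 *
              PassiveRIG.moment (PassiveRIG.degreeLaw Q β) 1 ^ 2 -
            PassiveRIG.moment (PassiveRIG.degreeLaw Q β) 1 ^ 4) /
          (PassiveRIG.moment (PassiveRIG.degreeLaw Q β) 1 *
              PassiveRIG.moment (PassiveRIG.degreeLaw Q β) 3 -
            PassiveRIG.moment (PassiveRIG.degreeLaw Q β) 2 ^ 2)))) ∧
    -- `β_n → ∞`
    (Tendsto (fun n : ℕ => (m n : ℝ) / n) atTop atTop →
      Tendsto (fun n : ℕ => PassiveRIG.assortativity n (P n) -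
        PassiveRIG.assortFormula (P n) ((m n : ℝ) / n)) atTop (𝓝 0) ∧
      ((∃ i j : ℕ, 2 ≤ i ∧ 2 ≤ j ∧ i ≠ j ∧ Q i ≠ 0 ∧ Q j ≠ 0) →
        Tendsto (fun n : ℕ => PassiveRIG.assortativity n (P n)) atTop (𝓝 1))) ∧
    -- `β_n → 0` and `n β_n³ → ∞`
    (Tendsto (fun n : ℕ => (m n : ℝ) / n) atTop (𝓝 0) →
      Tendsto (fun n : ℕ => (n : ℝ) * ((m n : ℝ) / n) ^ 3) atTop atTop →
      Tendsto (fun n : ℕ => PassiveRIG.assortativity n (P n)) atTop (𝓝 0)) := by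
  have h4 := (PassiveRIG.integrable_pow_iff Q 4).1 h_four
  have hz := PassiveRIG.factMoment_two_pos h4 h_two
  have hz3 : 0 ≤ PassiveRIG.factMoment Q 3 := ENNReal.toReal_nonneg
  have hV := PassiveRIG.sizeBiased_variance_limit_nonneg h4 hz
  have hy : ∀ i ∈ Finset.Icc 1 4, Tendsto (fun n => PassiveRIG.sizeFactMoment (P n) i) atTop
      (𝓝 (PassiveRIG.factMoment Q i)) := fun i hi =>
    PassiveRIG.tendsto_sizeFactMoment h_iii h4 h_lim hi
  refine ⟨fun β hβ hlim => ?_, fun hlim => ?_, fun hlim hcube => ?_⟩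
  · have hinv := hlim.inv₀ hβ.ne'
    have hsub := PassiveRIG.tendsto_assortativity_sub hm hy hz
      (PassiveRIG.tendsto_div_sq_of_tendsto_inv hm hinv)
    obtain ⟨hint, e1, e2, e3⟩ := PassiveRIG.degreeLaw_moments h4 hz hβ
    refine ⟨hsub, hint, ?_⟩
    have hpos : 0 < PassiveRIG.factMoment Q 2 * PassiveRIG.factMoment Q 4
        + PassiveRIG.factMoment Q 2 * PassiveRIG.factMoment Q 3 - PassiveRIG.factMoment Q 3 ^ 2
        + β⁻¹ * PassiveRIG.factMoment Q 2 ^ 2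
          * (PassiveRIG.factMoment Q 2 + PassiveRIG.factMoment Q 3) :=
      add_pos_of_nonneg_of_pos hV (by positivity)
    have h := hsub.add (PassiveRIG.tendsto_assortFormula hy hinv hpos.ne')
    simp only [sub_add_cancel, zero_add] at h
    convert h using 2
    rw [e1, e2, e3]
    generalize PassiveRIG.factMoment Q 2 = z₂ at *
    generalize PassiveRIG.factMoment Q 3 = z₃ at *
    generalize PassiveRIG.factMoment Q 4 = z₄ at *
    have hb : 0 < β⁻¹ := by positivity
    generalize β⁻¹ = b at *
    -- In terms of factorial moments the δ-quotient is b²·bU over b²(V + bU), so its complement to 1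
    -- is V/(V + bU), the limit of (1).
    have hden : b * z₂ * (b * (z₄ + 3 * z₃ + z₂) + 3 * (b * z₂ * (b * (z₃ + z₂))) + (b * z₂) ^ 3)
        - (b * (z₃ + z₂) + (b * z₂) ^ 2) ^ 2
        = b ^ 2 * (z₂ * z₄ + z₂ * z₃ - z₃ ^ 2 + b * z₂ ^ 2 * (z₂ + z₃)) := by ring
    have hnum : (b * (z₃ + z₂) + (b * z₂) ^ 2) * (b * z₂) ^ 2 - (b * z₂) ^ 4
        = b ^ 2 * (b * z₂ ^ 2 * (z₂ + z₃)) := by ring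
    rw [hden, hnum, mul_div_mul_left _ _ (pow_ne_zero 2 hb.ne'), eq_div_iff hpos.ne', sub_mul,
      div_mul_cancel₀ _ hpos.ne']
    ring
  · have hinv := tendsto_inv_atTop_zero.comp hlim
    have hsub := PassiveRIG.tendsto_assortativity_sub hm hy hz
      (PassiveRIG.tendsto_div_sq_of_tendsto_inv hm hinv)
    refine ⟨hsub, fun hij => ?_⟩
    -- Since β_n⁻¹ → 0, the limit of (1) is V/V, which is 1 only because two atoms make V positive.
    have hV' := PassiveRIG.sizeBiased_variance_limit_pos h4 hz hij
    have h := hsub.add (PassiveRIG.tendsto_assortFormula hy hinv (by simpa using hV'.ne'))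
    simpa only [sub_add_cancel, zero_add, zero_mul, add_zero, div_self hV'.ne'] using h
  · have hsub := PassiveRIG.tendsto_assortativity_sub hm hy hz
      (PassiveRIG.tendsto_div_sq_of_tendsto_cube hm hcube)
    have hpos : ∀ᶠ n : ℕ in atTop, (m n : ℝ) / n ∈ Set.Ioi (0 : ℝ) := by
      filter_upwards [eventually_gt_atTop 0, hm.eventually_gt_atTop 0] with n hn hmn
      have hn' : (0 : ℝ) < n := by exact_mod_cast hn
      have hm' : (0 : ℝ) < m n := by exact_mod_cast hmn
      exact div_pos hm' hn'
    have h := hsub.add (PassiveRIG.tendsto_assortFormula_zero hy hz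
      (tendsto_inv_nhdsGT_zero.comp (tendsto_nhdsWithin_iff.2 ⟨hlim, hpos⟩)))
    simpa only [sub_add_cancel, zero_add] using h
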